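/- **Setting.** Let $d\ge 1$, $n\in[0,\infty)$ and $h\in(-\infty,1)$. The splitting automaton on $\mathbb Z^d$ is the sequence of configurations $\eta_t:\mathbb Z^d\to\mathbb R$, $t=0,1,2,\dots$, with $\eta_0(\mathbf 0)=n$ and $\eta_0(\mathbf x)=h$ for $\mathbf x\neq\mathbf 0$, in which at every time step all sites of mass at least $1$ split simultaneously: with $\mathcal S_{t+1}=\{\mathbf x:\eta_t(\mathbf x)\ge 1\}$, $$\eta_{t+1}(\mathbf x)=\eta_t(\mathbf x)\bigl(1-\mathbf 1_{\mathbf x\in\mathcal S_{t+1}}\bigr)+\frac1{2d}\sum_{\mathbf y\in\mathcal S_{t+1},\ \mathbf y\sim\mathbf x}\eta_t(\mathbf y),$$ where $\mathbf y\sim\mathbf x$ means that $\mathbf x$ and $\mathbf y$ are nearest neighbours. Let $\mathcal T_t=\bigcup_{0<t'\le t}\mathcal S_{t'}$ be the set of sites that have split at least once until time $t$. Let $\mathbf C=\{\mathbf x\in\mathbb R^d:\max_i|x_i|\le\frac12\}$. A set $\mathbf S\subset\mathbb R^d$ whose largest coordinate is $1$, i.e. $\max\{x_i:\mathbf x\in\mathbf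 S,\ 1\le i\le d\}=1$, is the *limiting shape of the splitting automaton, with scaling function* $f$, if for every $\epsilon>0$ there is a $t^\epsilon$ such that for all integers $t>t^\epsilon$ $$\mathbf S_\epsilon\subseteq f(t)\,(\mathcal T_t+\mathbf C)\subseteq\mathbf S^\epsilon ,$$ where $\mathbf S_\epsilon=\{\mathbf x: B(\mathbf x,\epsilon)\subseteq\mathbf S\}$ and $\mathbf S^\epsilon=\bigcup_{\mathbf x\in\mathbf S}B(\mathbf x,\epsilon)$ are the inner and outer $\epsilon$-neighbourhoods of $\mathbf S$, and $B(\mathbf x,\epsilon)$ is the open Euclidean ball. Let $\mathbf D=\{\mathbf x\in\mathbb R^d:\sum_i|x_i|\le1\}$ (the diamond), let $\mathbf Q=\{\mathbf x\in\mathbb R^2:\max_i|x_i|\le1\}$ (the square), and let $\mathbf O\subset\mathbb R^2$ be the (filled) octagon with the eight vertices $(0,\pm1)$, $(\pm1,0)$, $(\pm\frac56,\pm\frac56)$. **Theorem.** 1. For every $d\ge1$, $1-\frac1{2d}\le h<1$ and $n\ge1$, the limiting shape of the splitting automaton on $\mathbb Z^d$ is the diamond $\mathbf D$, with scaling function $f(t)=\frac1t$.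 2. For $\frac7{10}\le h<\frac{40}{57}$ and $4-4h\le n\le16-20h$, the limiting shape of the splitting automaton on $\mathbb Z^2$ is the square $\mathbf Q$, with scaling function $f(t)=\frac2t$. 3. For $\frac57\le h<\frac{13}{18}$ and $n=3$, the limiting shape of the splitting automaton on $\mathbb Z^2$ is the octagon $\mathbf O$, with scaling function $f(t)=\frac5{3t}$. -/

import Mathlib

open scoped Pointwise

noncomputable section

namespace SplittingModel

/-- Sites of the lattice `ℤ^d`. -/
abbrev Site (d : ℕ) : Type := Fin d → ℤ

/-- A configuration: the mass at each site. -/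
abbrev Config (d : ℕ) : Type := Site d → ℝ

/-- The initial configuration: mass `n` at the origin and mass `h` at every other site. -/
def initial (d : ℕ) (n h : ℝ) : Config d :=
  fun x => if x = 0 then n else h

/-- The unstable sites of a configuration: the sites of mass at least `1`. -/
def unstable {d : ℕ} (η : Config d) : Set (Site d) :=
  {x | 1 ≤ η x}

/-- The configuration obtained from `η` when exactly the sites of `S` split, simultaneously:
a site of `S` loses its mass, which is divided equally over its `2d` nearest neighbours.
The nearest neighbours of `x` are `x + e_i` and `x - e_i`, for `i` a coordinate. -/
def split {d : ℕ} (S : Set (Site d)) (η : Config d) : Config d := fun x =>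
  η x * (1 - S.indicator 1 x) +
    1 / (2 * (d : ℝ)) *
      ∑ i : Fin d, (S.indicator η (x + Pi.single i 1) + S.indicator η (x - Pi.single i 1))

/-- The configuration at time `t` of the splitting automaton (parallel splitting order):
at each time step all unstable sites split. -/
def config (d : ℕ) (n h : ℝ) : ℕ → Config d
  | 0 => initial d n h
  | t + 1 => split (unstable (config d n h t)) (config d n h t)

/-- The set of sites that have split at least once until time `t`. The sites that split at
time `s + 1` are the sites that are unstable at time `s`. -/
def splitCluster (d : ℕ) (n h : ℝ) (t : ℕ) : Set (Site d) :=
  {x | ∃ s < t, x ∈ unstable (config d n h s)}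

/-- A site of `ℤ^d` as a point of `ℝ^d`. -/
def toPoint {d : ℕ} (x : Site d) : EuclideanSpace ℝ (Fin d) :=
  WithLp.toLp 2 (fun i => (x i : ℝ))

/-- The cube of radius `1/2` centred at the origin of `ℝ^d`. -/
def cube (d : ℕ) : Set (EuclideanSpace ℝ (Fin d)) :=
  {v | ∀ i, |v i| ≤ 1 / 2}

/-- The volume `V + C`: the union of the cubes of radius `1/2` centred at the sites of `V`. -/
def volumeOf {d : ℕ} (V : Set (Site d)) : Set (EuclideanSpace ℝ (Fin d)) :=
  toPoint '' V + cube d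

/-- The inner `ε`-neighbourhood of `S`: the points whose open `ε`-ball lies in `S`. The outer
`ε`-neighbourhood is `Metric.thickening ε S`. -/
def innerNeighborhood {d : ℕ} (ε : ℝ) (S : Set (EuclideanSpace ℝ (Fin d))) :
    Set (EuclideanSpace ℝ (Fin d)) :=
  {x | Metric.ball x ε ⊆ S}

/-- `S` is the limiting shape of the sequence `V` with scaling function `f`: the largest
coordinate of a point of `S` is `1`, and for every `ε > 0` the rescaled volume `f t • (V t + C)`
lies between the inner and outer `ε`-neighbourhoods of `S` for all large `t`. -/
def IsLimitingShape {d : ℕ} (S : Set (EuclideanSpace ℝ (Fin d))) (V : ℕ → Set (Site d))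
    (f : ℕ → ℝ) : Prop :=
  IsGreatest {r : ℝ | ∃ x ∈ S, ∃ i, r = x i} 1 ∧
    ∀ ε : ℝ, 0 < ε → ∃ t₀ : ℕ, ∀ t : ℕ, t₀ < t →
      innerNeighborhood ε S ⊆ f t • volumeOf (V t) ∧
        f t • volumeOf (V t) ⊆ Metric.thickening ε S

/-- The diamond of radius `1` in `ℝ^d`. -/
def diamond (d : ℕ) : Set (EuclideanSpace ℝ (Fin d)) :=
  {x | ∑ i, |x i| ≤ 1}

/-- The square of radius `1` in `ℝ^2`. -/
def square : Set (EuclideanSpace ℝ (Fin 2)) :=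
  {x | ∀ i, |x i| ≤ 1}

/-- The octagon in `ℝ^2` with vertices `(0, 1)` and `(5/6, 5/6)` and their images under the
symmetries of the square. -/
def octagon : Set (EuclideanSpace ℝ (Fin 2)) :=
  convexHull ℝ {!₂[0, 1], !₂[5 / 6, 5 / 6], !₂[1, 0], !₂[5 / 6, -(5 / 6)],
    !₂[0, -1], !₂[-(5 / 6), -(5 / 6)], !₂[-1, 0], !₂[-(5 / 6), 5 / 6]}

end SplittingModel

end

namespace SplittingModel

/-! Only the first splitting time of each site matters. If it stays within a bounded distance of `a
* N y` for a gauge `N`, then the cluster at time `t` is, up to a bounded error, the ball `N ≤ t /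
a`, and scaling by `a / t` leaves the unit ball of `N` in the limit (`isLimitingShape_of_gauge`).

For the diamond the time is exactly the graph norm. Influence travels one lattice step per time
step, and `1 - 1 / (2 * d) ≤ h` lets a single unstable neighbour destabilise an untouched site.

In the plane, reflections reduce the configuration to the wedge sites `(x, x + j)`, and instability
lives on one checkerboard colour at a time, so two time steps fuse into one recursion. The first
splitting times are given in closed form and proved by induction on time, carrying intervals for the
masses of sites before, at and shortly after their first splitting. The bounds on `h` make these
intervals close up.

In the square regime, waves alternate between light masses in `[1, 4 - 4 * h)`, which cannot by
themselves trigger the site straight ahead, and heavy masses of at least `4 - 4 * h`, which can.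
Right after its first splitting a site away from the start is silent for one round, which shields
the front from the wake; further back a bound growing linearly with age suffices (`square_states`).
At `n = 16 - 20 * h` the first light site becomes heavy and the parities exchange roles
(`critical_states`). In both cases the time is twice the largest coordinate, up to a constant.

In the octagon regime the site `(x, x + 3 * m + r)`, `r < 3`, first splits at `2 * x + 5 * m + r`
and then at every second step, since averaging over four splitting neighbours preserves `[1, 53 /
25]` (`octagon_states`). This time is close to `5 / 3 * (max + min / 5)` in the absolute
coordinates. -/

/-! ### From first splitting times to limiting shapes -/

lemma norm_le_of_mem_cube {d : ℕ} {v : EuclideanSpace ℝ (Fin d)} (hv : v ∈ cube d) :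
    ‖v‖ ≤ √d := by
  rw [EuclideanSpace.norm_eq]
  apply Real.sqrt_le_sqrt
  calc ∑ i, ‖v i‖ ^ 2 ≤ ∑ _i : Fin d, (1 : ℝ) := by
        refine Finset.sum_le_sum fun i _ => ?_
        have h1 : ‖v i‖ ≤ 1 / 2 := hv i
        have h2 := norm_nonneg (v i)
        nlinarith
    _ = d := by simp

lemma exists_toPoint_add_mem_cube {d : ℕ} (z : EuclideanSpace ℝ (Fin d)) :
    ∃ y : Site d, z - toPoint y ∈ cube d :=
  ⟨fun i => round (z i), fun i => by simpa [toPoint] using abs_sub_round (z i)⟩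

/-- If every site `y` is reached at a time that differs boundedly from `a * N y`, for a gauge `N`,
then the limiting shape is the unit ball of `N`. -/
theorem isLimitingShape_of_gauge {d : ℕ} {N : EuclideanSpace ℝ (Fin d) → ℝ}
    {V : ℕ → Set (Site d)} {τ : Site d → ℕ} {a K c C : ℝ} (ha : 0 < a) (hc : 0 < c) (hC : 0 ≤ C)
    (hsmul : ∀ r, 0 ≤ r → ∀ v, N (r • v) = r * N v) (hadd : ∀ u v, N (u + v) ≤ N u + N v)
    (hlow : ∀ v, c * ‖v‖ ≤ N v) (hup : ∀ v, N v ≤ C * ‖v‖)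
    (hmax : IsGreatest {r : ℝ | ∃ x ∈ {v | N v ≤ 1}, ∃ i, r = x i} 1)
    (hV : ∀ t y, y ∈ V t ↔ τ y < t) (hτ : ∀ y, |a * N (toPoint y) - τ y| ≤ K) :
    IsLimitingShape {v | N v ≤ 1} V (fun t : ℕ => a / (t : ℝ)) := by
  refine ⟨hmax, fun ε hε => ?_⟩
  have hK : 0 ≤ K := (abs_nonneg _).trans (hτ 0)
  set R : ℝ := √d
  have hR : 0 ≤ R := Real.sqrt_nonneg _
  -- Total error in `a * N`: `K` from the splitting times, the rest from displacements inside a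
  -- cube.
  set L : ℝ := K + a * (C * R)
  have hL : 0 ≤ L := by positivity
  set δ : ℝ := min (c * ε / 2) 1
  have hδ : 0 < δ := lt_min (by positivity) one_pos
  have hcube : ∀ v ∈ cube d, N v ≤ C * R := fun v hv =>
    (hup v).trans (mul_le_mul_of_nonneg_left (norm_le_of_mem_cube hv) hC)
  obtain ⟨t₀, ht₀⟩ := exists_nat_ge (max 1 (max (L / δ) (L * ((1 + L) / c) / ε)))
  refine ⟨t₀, fun t ht => ?_⟩
  have htt : max 1 (max (L / δ) (L * ((1 + L) / c) / ε)) < (t : ℝ) :=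
    ht₀.trans_lt (by exact_mod_cast ht)
  rw [max_lt_iff, max_lt_iff, div_lt_iff₀ hδ, div_lt_iff₀ hε] at htt
  obtain ⟨ht1, htδ, htε⟩ := htt
  have htpos : (0 : ℝ) < t := by linarith
  constructor
  · intro x hx
    have hNx : N x + δ ≤ 1 := by
      rcases eq_or_ne x 0 with rfl | hx0
      · have : N (0 : EuclideanSpace ℝ (Fin d)) = 0 := by
          simpa using hsmul 0 le_rfl 0
        rw [this, zero_add]
        exact min_le_right _ _
      · have hxn : 0 < ‖x‖ := norm_pos_iff.mpr hx0
        -- Pushing `x` radially outwards by `ε / 2` stays in the ball, hence in the shape, so `N x`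
        -- is below `1` by a definite margin `δ`.
        have hmem : (1 + ε / (2 * ‖x‖)) • x ∈ Metric.ball x ε := by
          rw [Metric.mem_ball, dist_eq_norm, add_smul, one_smul, add_sub_cancel_left, norm_smul,
            Real.norm_of_nonneg (by positivity)]
          have : ε / (2 * ‖x‖) * ‖x‖ = ε / 2 := by field_simp
          linarith
        have h1 : N ((1 + ε / (2 * ‖x‖)) • x) ≤ 1 := hx hmem
        rw [hsmul _ (by positivity)] at h1
        have h2 : ε / (2 * ‖x‖) * (c * ‖x‖) ≤ ε / (2 * ‖x‖) * N x :=
          mul_le_mul_of_nonneg_left (hlow x) (by positivity)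
        have h3 : ε / (2 * ‖x‖) * (c * ‖x‖) = c * ε / 2 := by field_simp
        have h4 : δ ≤ c * ε / 2 := min_le_left _ _
        linarith
    obtain ⟨y, hy⟩ := exists_toPoint_add_mem_cube (((t : ℝ) / a) • x)
    have hneg : toPoint y - ((t : ℝ) / a) • x ∈ cube d := by
      intro i
      have := hy i
      rw [← neg_sub, PiLp.neg_apply, abs_neg]
      exact this
    have hNy : N (toPoint y) ≤ t / a * N x + C * R := by
      have h1 := hadd (((t : ℝ) / a) • x) (toPoint y - ((t : ℝ) / a) • x)
      rw [add_sub_cancel, hsmul _ (by positivity)] at h1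
      linarith [hcube _ hneg]
    have hyV : y ∈ V t := by
      rw [hV]
      have h1 := (abs_le.mp (hτ y)).1
      have h2 : a * N (toPoint y) ≤ t * N x + a * (C * R) := by
        calc a * N (toPoint y) ≤ a * (t / a * N x + C * R) := by gcongr
          _ = t * N x + a * (C * R) := by field_simp
      have h3 : (t : ℝ) * (N x + δ) ≤ t * 1 := by gcongr
      have : (τ y : ℝ) < t := by
        have hLd : L = K + a * (C * R) := rfl
        linarith
      exact_mod_cast this
    refine Set.mem_smul_set.mpr ⟨((t : ℝ) / a) • x, ?_, ?_⟩
    · exact Set.mem_add.mpr ⟨_, Set.mem_image_of_mem _ hyV, _, hy, by abel⟩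
    · rw [smul_smul, div_mul_div_comm, mul_comm a, div_self (by positivity), one_smul]
  · intro p hp
    obtain ⟨z, hz, rfl⟩ := Set.mem_smul_set.mp hp
    obtain ⟨_, ⟨y, hy, rfl⟩, v, hv, rfl⟩ := Set.mem_add.mp hz
    simp only
    set p : EuclideanSpace ℝ (Fin d) := (a / (t : ℝ)) • (toPoint y + v) with hpdef
    have hyt : (τ y : ℝ) < t := by exact_mod_cast (hV t y).mp hy
    have hNp : N p ≤ 1 + L / t := by
      have h1 := (abs_le.mp (hτ y)).2
      have h2 : a * N (toPoint y + v) ≤ t + L := by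
        calc a * N (toPoint y + v) ≤ a * (N (toPoint y) + C * R) := by
              gcongr
              exact (hadd _ _).trans (by linarith [hcube v hv])
          _ = a * N (toPoint y) + a * (C * R) := by ring
          _ ≤ t + L := by
              have hLd : L = K + a * (C * R) := rfl
              linarith
      rw [hpdef, hsmul _ (by positivity)]
      calc a / t * N (toPoint y + v) = a * N (toPoint y + v) / t := by ring
        _ ≤ (t + L) / t := by gcongr
        _ = 1 + L / t := by field_simp
    have hLt : L / t ≤ L := div_le_self hL ht1.le
    have hLt0 : 0 ≤ L / t := by positivity
    have hpn : ‖p‖ ≤ (1 + L) / c := by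
      rw [le_div_iff₀ hc, mul_comm]
      linarith [hlow p]
    rw [Metric.mem_thickening_iff]
    -- `N p` exceeds `1` by at most `L / t`, so a radial contraction brings `p` into the unit ball
    -- at a cost tending to zero.
    refine ⟨(1 + L / t)⁻¹ • p, ?_, ?_⟩
    · change N ((1 + L / t)⁻¹ • p) ≤ 1
      rw [hsmul _ (by positivity), inv_mul_le_iff₀ (by positivity)]
      linarith
    · have h1 : p - (1 + L / t)⁻¹ • p = (L / t * (1 + L / t)⁻¹) • p := by
        have : L / t * (1 + L / t)⁻¹ = 1 - (1 + L / t)⁻¹ := by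
          have : 1 + L / t ≠ 0 := by positivity
          field_simp
          ring
        rw [this, sub_smul, one_smul]
      rw [dist_eq_norm, h1, norm_smul, Real.norm_of_nonneg (by positivity)]
      have h2 : (1 + L / t)⁻¹ ≤ 1 := inv_le_one_of_one_le₀ (by linarith)
      calc L / t * (1 + L / t)⁻¹ * ‖p‖ ≤ L / t * 1 * ((1 + L) / c) := by gcongr
        _ = L * ((1 + L) / c) / t := by ring
        _ < ε := by rw [div_lt_iff₀ htpos]; linarith

/-! ### A single splitting step -/

/-- The mass that a site of mass `v` sends out. -/
noncomputable def fire (v : ℝ) : ℝ := if 1 ≤ v then v else 0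

/-- The mass that a site of mass `v` keeps. -/
noncomputable def rest (v : ℝ) : ℝ := if 1 ≤ v then 0 else v

lemma fire_of_le {v : ℝ} (hv : 1 ≤ v) : fire v = v := if_pos hv

lemma fire_of_lt {v : ℝ} (hv : v < 1) : fire v = 0 := if_neg (not_le.mpr hv)

lemma rest_of_le {v : ℝ} (hv : 1 ≤ v) : rest v = 0 := if_pos hv

lemma rest_of_lt {v : ℝ} (hv : v < 1) : rest v = v := if_neg (not_le.mpr hv)

lemma fire_nonneg (v : ℝ) : 0 ≤ fire v := by
  unfold fire; split_ifs <;> linarith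

lemma rest_lt_one (v : ℝ) : rest v < 1 := by
  unfold rest; split_ifs <;> linarith

lemma indicator_unstable {d : ℕ} (η : Config d) (x : Site d) :
    (unstable η).indicator η x = fire (η x) := by
  by_cases hx : 1 ≤ η x <;> simp [Set.indicator, unstable, fire, hx]

lemma mul_one_sub_indicator {d : ℕ} (η : Config d) (x : Site d) :
    η x * (1 - (unstable η).indicator 1 x) = rest (η x) := by
  by_cases hx : 1 ≤ η x <;> simp [Set.indicator, unstable, rest, hx]

lemma config_succ (d : ℕ) (n h : ℝ) (t : ℕ) (x : Site d) :
    config d n h (t + 1) x = rest (config d n h t x) + 1 / (2 * (d : ℝ)) *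
      ∑ i : Fin d, (fire (config d n h t (x + Pi.single i 1)) +
        fire (config d n h t (x - Pi.single i 1))) := by
  simp only [config, split, indicator_unstable, mul_one_sub_indicator]

/-! ### Symmetries of the plane and the fundamental wedge -/

/-- The mass at the site `(a, b)` of `ℤ²` at time `t`. -/
noncomputable def planar (n h : ℝ) (t : ℕ) (a b : ℤ) : ℝ := config 2 n h t ![a, b]

lemma planar_succ (n h : ℝ) (t : ℕ) (a b : ℤ) :
    planar n h (t + 1) a b = rest (planar n h t a b) +
      (fire (planar n h t (a + 1) b) + fire (planar n h t (a - 1) b) +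
        fire (planar n h t a (b + 1)) + fire (planar n h t a (b - 1))) / 4 := by
  have e1 : (![a, b] + Pi.single 0 1 : Fin 2 → ℤ) = ![a + 1, b] := by
    ext i; fin_cases i <;> simp
  have e2 : (![a, b] - Pi.single 0 1 : Fin 2 → ℤ) = ![a - 1, b] := by
    ext i; fin_cases i <;> simp
  have e3 : (![a, b] + Pi.single 1 1 : Fin 2 → ℤ) = ![a, b + 1] := by
    ext i; fin_cases i <;> simp
  have e4 : (![a, b] - Pi.single 1 1 : Fin 2 → ℤ) = ![a, b - 1] := by
    ext i; fin_cases i <;> simp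
  rw [planar, config_succ, Fin.sum_univ_two, e1, e2, e3, e4]
  simp only [planar]
  push_cast
  ring

lemma planar_zero (n h : ℝ) (a b : ℤ) :
    planar n h 0 a b = if a = 0 ∧ b = 0 then n else h := by
  have : (![a, b] = (0 : Fin 2 → ℤ)) ↔ a = 0 ∧ b = 0 := by
    constructor
    · intro e
      exact ⟨congrFun e 0, congrFun e 1⟩
    · rintro ⟨rfl, rfl⟩
      ext i; fin_cases i <;> rfl
  simp [planar, config, initial, this]

lemma planar_neg (n h : ℝ) (t : ℕ) (a b : ℤ) : planar n h t (-a) b = planar n h t a b := by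
  induction t generalizing a b with
  | zero => simp [planar_zero]
  | succ t ih =>
    rw [planar_succ, planar_succ, ← ih a b, ← ih (a + 1) b, ← ih (a - 1) b, ← ih a (b + 1),
      ← ih a (b - 1), show -a + 1 = -(a - 1) by ring, show -a - 1 = -(a + 1) by ring]
    ring

lemma planar_swap (n h : ℝ) (t : ℕ) (a b : ℤ) : planar n h t b a = planar n h t a b := by
  induction t generalizing a b with
  | zero => simp [planar_zero, and_comm]
  | succ t ih =>
    rw [planar_succ, planar_succ, ih a b, ih (a + 1) b, ih (a - 1) b, ih a (b + 1), ih a (b - 1)]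
    ring

/-- The mass at the site `(x, x + j)` at time `t`. By symmetry these masses determine the
configuration. -/
noncomputable def wedge (n h : ℝ) (t x j : ℕ) : ℝ := planar n h t x (x + j)

/-- The coordinates of a site in the fundamental wedge: `x = min |a| |b|`. -/
lemma planar_eq_wedge (n h : ℝ) (t : ℕ) (a b : ℤ) :
    planar n h t a b = wedge n h t (min a.natAbs b.natAbs)
      (max a.natAbs b.natAbs - min a.natAbs b.natAbs) := by
  have habs : planar n h t a b = planar n h t |a| |b| := by
    have h1 : ∀ a b : ℤ, planar n h t |a| b = planar n h t a b := by
      intro a b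
      rcases abs_choice a with e | e <;> rw [e]
      exact planar_neg n h t a b
    rw [h1 a, planar_swap n h t |b| a, h1 b, planar_swap]
  rw [habs, wedge, Int.abs_eq_natAbs, Int.abs_eq_natAbs]
  rcases le_total a.natAbs b.natAbs with hab | hab
  · rw [min_eq_left hab, max_eq_right hab]
    congr 1
    omega
  · rw [min_eq_right hab, max_eq_left hab, planar_swap]
    congr 1
    omega

section Dynamics

variable {n h : ℝ}

lemma wedge_zero (x j : ℕ) : wedge n h 0 x j = if x = 0 ∧ j = 0 then n else h := by
  rw [wedge, planar_zero]
  congr 1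
  ext
  omega

lemma wedge_zero_zero : wedge n h 0 0 0 = n := by simp [wedge_zero]

lemma wedge_zero_of_ne (x j : ℕ) (hxj : 0 < x + j) : wedge n h 0 x j = h := by
  rw [wedge_zero, if_neg (by omega)]

/-- Neighbours outside the wedge are reflected back into it, here and in the next three recursions:
all four coincide at the origin, the two sideways ones coincide on the axis, and they pair up on the
diagonal. -/
lemma wedge_succ_origin (t : ℕ) :
    wedge n h (t + 1) 0 0 = rest (wedge n h t 0 0) + fire (wedge n h t 0 1) := by
  have e1 : planar n h t 1 0 = planar n h t 0 1 := planar_swap ..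
  have e2 : planar n h t (-1) 0 = planar n h t 0 1 := by rw [planar_neg, e1]
  have e3 : planar n h t 0 (-1) = planar n h t 0 1 := by rw [← planar_swap, e2]
  simp only [wedge, planar_succ]
  norm_num [e1, e2, e3]
  ring

lemma wedge_succ_axis (t j : ℕ) :
    wedge n h (t + 1) 0 (j + 1) = rest (wedge n h t 0 (j + 1)) +
      (fire (wedge n h t 0 (j + 2)) + fire (wedge n h t 0 j) + 2 * fire (wedge n h t 1 j)) / 4 := by
  have e2 : planar n h t (-1) (j + 1) = planar n h t 1 (j + 1) := planar_neg ..
  simp only [wedge, planar_succ]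
  push_cast
  norm_num [add_assoc, add_comm (1 : ℤ)]
  rw [e2]
  ring

lemma wedge_succ_diagonal (t x : ℕ) :
    wedge n h (t + 1) (x + 1) 0 = rest (wedge n h t (x + 1) 0) +
      (2 * fire (wedge n h t (x + 1) 1) + 2 * fire (wedge n h t x 1)) / 4 := by
  have e1 : planar n h t (x + 1 + 1) (x + 1) = planar n h t (x + 1) (x + 1 + 1) := planar_swap ..
  have e2 : planar n h t (x + 1) x = planar n h t x (x + 1) := planar_swap ..
  simp only [wedge, planar_succ]
  push_cast
  simp only [add_zero, add_sub_cancel_right, e1, e2]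
  ring

lemma wedge_succ_interior (t x j : ℕ) :
    wedge n h (t + 1) (x + 1) (j + 1) = rest (wedge n h t (x + 1) (j + 1)) +
      (fire (wedge n h t (x + 1) (j + 2)) + fire (wedge n h t (x + 1) j) +
        fire (wedge n h t (x + 2) j) + fire (wedge n h t x (j + 2))) / 4 := by
  simp only [wedge, planar_succ]
  push_cast
  rw [show (x : ℤ) + 1 + (j + 1) + 1 = x + 1 + (j + 2) by ring,
    show (x : ℤ) + 1 + (j + 1) - 1 = x + 1 + j by ring,
    show (x : ℤ) + 1 + 1 = x + 2 by ring, show (x : ℤ) + 2 + j = x + 1 + (j + 1) by ring,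
    show (x : ℤ) + 1 - 1 = x by ring, show (x : ℤ) + (j + 2) = x + 1 + (j + 1) by ring]
  ring

/-! ### Parity and the two-step recursion -/

/-- Only sites whose coordinate sum has the parity of `t` can be unstable at time `t`. -/
lemma wedge_lt_one_of_odd (hh : h < 1) (t x j : ℕ) (hp : (t + j) % 2 = 1) :
    wedge n h t x j < 1 := by
  induction t generalizing x j with
  | zero => rw [wedge_zero_of_ne _ _ (by omega)]; exact hh
  | succ t ih =>
    have hr := rest_lt_one (wedge n h t x j)
    rcases x with _ | x <;> rcases j with _ | j
    · rw [wedge_succ_origin, fire_of_lt (ih 0 1 (by omega))]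
      linarith
    · rw [wedge_succ_axis, fire_of_lt (ih 0 (j + 2) (by omega)), fire_of_lt (ih 0 j (by omega)),
        fire_of_lt (ih 1 j (by omega))]
      linarith
    · rw [wedge_succ_diagonal, fire_of_lt (ih (x + 1) 1 (by omega)),
        fire_of_lt (ih x 1 (by omega))]
      linarith
    · rw [wedge_succ_interior, fire_of_lt (ih (x + 1) (j + 2) (by omega)),
        fire_of_lt (ih (x + 1) j (by omega)), fire_of_lt (ih (x + 2) j (by omega)),
        fire_of_lt (ih x (j + 2) (by omega))]
      linarith

/-- At time `t` all neighbours have the wrong parity and send nothing, so the site merely retains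
its rest until `t + 1`. This allows two time steps to be fused. -/
lemma rest_wedge_succ (hh : h < 1) (t x j : ℕ) (hp : (t + j) % 2 = 0) :
    rest (wedge n h (t + 1) x j) = rest (wedge n h t x j) := by
  have key := fun x j hp => fire_of_lt (wedge_lt_one_of_odd (n := n) hh t x j hp)
  rw [rest_of_lt (wedge_lt_one_of_odd hh (t + 1) x j (by omega))]
  rcases x with _ | x <;> rcases j with _ | j
  · rw [wedge_succ_origin, key 0 1 (by omega), add_zero]
  · rw [wedge_succ_axis, key 0 (j + 2) (by omega), key 0 j (by omega), key 1 j (by omega)]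
    ring
  · rw [wedge_succ_diagonal, key (x + 1) 1 (by omega), key x 1 (by omega)]
    ring
  · rw [wedge_succ_interior, key (x + 1) (j + 2) (by omega), key (x + 1) j (by omega),
      key (x + 2) j (by omega), key x (j + 2) (by omega)]
    ring

lemma wedge_two_step_origin (hh : h < 1) (t : ℕ) (hp : t % 2 = 0) :
    wedge n h (t + 2) 0 0 = rest (wedge n h t 0 0) + fire (wedge n h (t + 1) 0 1) := by
  rw [wedge_succ_origin, rest_wedge_succ hh _ _ _ (by omega)]

lemma wedge_two_step_axis (hh : h < 1) (t j : ℕ) (hp : (t + j) % 2 = 1) :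
    wedge n h (t + 2) 0 (j + 1) = rest (wedge n h t 0 (j + 1)) +
      (fire (wedge n h (t + 1) 0 (j + 2)) + fire (wedge n h (t + 1) 0 j) +
        2 * fire (wedge n h (t + 1) 1 j)) / 4 := by
  rw [wedge_succ_axis, rest_wedge_succ hh _ _ _ (by omega)]

lemma wedge_two_step_diagonal (hh : h < 1) (t x : ℕ) (hp : t % 2 = 0) :
    wedge n h (t + 2) (x + 1) 0 = rest (wedge n h t (x + 1) 0) +
      (2 * fire (wedge n h (t + 1) (x + 1) 1) + 2 * fire (wedge n h (t + 1) x 1)) / 4 := by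
  rw [wedge_succ_diagonal, rest_wedge_succ hh _ _ _ (by omega)]

lemma wedge_two_step_interior (hh : h < 1) (t x j : ℕ) (hp : (t + j) % 2 = 1) :
    wedge n h (t + 2) (x + 1) (j + 1) = rest (wedge n h t (x + 1) (j + 1)) +
      (fire (wedge n h (t + 1) (x + 1) (j + 2)) + fire (wedge n h (t + 1) (x + 1) j) +
        fire (wedge n h (t + 1) (x + 2) j) + fire (wedge n h (t + 1) x (j + 2))) / 4 := by
  rw [wedge_succ_interior, rest_wedge_succ hh _ _ _ (by omega)]

lemma wedge_one_axis (hh : h < 1) (hn : 1 ≤ n) : wedge n h 1 0 1 = h + n / 4 := by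
  rw [wedge_succ_axis, wedge_zero_of_ne 0 (0 + 1) (by omega),
    wedge_zero_of_ne 0 (0 + 2) (by omega), wedge_zero_of_ne 1 0 (by omega), wedge_zero_zero,
    fire_of_lt hh, rest_of_lt hh, fire_of_le hn]
  ring

lemma wedge_one_of_odd (hh : h < 1) (x j : ℕ) (hj : j % 2 = 1) (hxj : 1 < x + j) :
    wedge n h 1 x j = h := by
  obtain ⟨j, rfl⟩ : ∃ i, j = i + 1 := ⟨j - 1, by omega⟩
  rcases x with _ | x
  · rw [wedge_succ_axis, wedge_zero_of_ne _ _ (by omega), wedge_zero_of_ne _ _ (by omega),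
      wedge_zero_of_ne _ _ (by omega), wedge_zero_of_ne _ _ (by omega), fire_of_lt hh,
      rest_of_lt hh]
    ring
  · rw [wedge_succ_interior, wedge_zero_of_ne _ _ (by omega), wedge_zero_of_ne _ _ (by omega),
      wedge_zero_of_ne _ _ (by omega), wedge_zero_of_ne _ _ (by omega),
      wedge_zero_of_ne _ _ (by omega), fire_of_lt hh, rest_of_lt hh]
    ring

end Dynamics

/-! ### Recursions on the two checkerboard colours -/

/-- The mass at time `2k` of the wedge site `(x, 2m)`. -/
noncomputable def evenMass (n h : ℝ) (k x m : ℕ) : ℝ := wedge n h (2 * k) x (2 * m)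

/-- The mass at time `2k + 1` of the wedge site `(x, 2m + 1)`. -/
noncomputable def oddMass (n h : ℝ) (k x m : ℕ) : ℝ := wedge n h (2 * k + 1) x (2 * m + 1)

section Recursion

variable {n h : ℝ}

lemma evenMass_zero_origin : evenMass n h 0 0 0 = n := wedge_zero_zero

lemma evenMass_zero (x m : ℕ) (hxm : 0 < x + m) : evenMass n h 0 x m = h :=
  wedge_zero_of_ne _ _ (by omega)

lemma oddMass_zero_origin (hh : h < 1) (hn : 1 ≤ n) : oddMass n h 0 0 0 = h + n / 4 :=
  wedge_one_axis hh hn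

lemma oddMass_zero (hh : h < 1) (x m : ℕ) (hxm : 0 < x + m) : oddMass n h 0 x m = h :=
  wedge_one_of_odd hh _ _ (by omega) (by omega)

lemma oddMass_succ_axis (hh : h < 1) (k m : ℕ) :
    oddMass n h (k + 1) 0 m = rest (oddMass n h k 0 m) +
      (fire (evenMass n h (k + 1) 0 (m + 1)) + fire (evenMass n h (k + 1) 0 m) +
        2 * fire (evenMass n h (k + 1) 1 m)) / 4 :=
  wedge_two_step_axis hh (2 * k + 1) (2 * m) (by omega)

lemma oddMass_succ_interior (hh : h < 1) (k x m : ℕ) :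
    oddMass n h (k + 1) (x + 1) m = rest (oddMass n h k (x + 1) m) +
      (fire (evenMass n h (k + 1) (x + 1) (m + 1)) + fire (evenMass n h (k + 1) (x + 1) m) +
        fire (evenMass n h (k + 1) (x + 2) m) + fire (evenMass n h (k + 1) x (m + 1))) / 4 :=
  wedge_two_step_interior hh (2 * k + 1) x (2 * m) (by omega)

lemma evenMass_succ_origin (hh : h < 1) (k : ℕ) :
    evenMass n h (k + 1) 0 0 = rest (evenMass n h k 0 0) + fire (oddMass n h k 0 0) :=
  wedge_two_step_origin hh (2 * k) (by omega)

lemma evenMass_succ_diagonal (hh : h < 1) (k x : ℕ) :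
    evenMass n h (k + 1) (x + 1) 0 = rest (evenMass n h k (x + 1) 0) +
      (2 * fire (oddMass n h k (x + 1) 0) + 2 * fire (oddMass n h k x 0)) / 4 :=
  wedge_two_step_diagonal hh (2 * k) x (by omega)

lemma evenMass_succ_axis (hh : h < 1) (k m : ℕ) :
    evenMass n h (k + 1) 0 (m + 1) = rest (evenMass n h k 0 (m + 1)) +
      (fire (oddMass n h k 0 (m + 1)) + fire (oddMass n h k 0 m) +
        2 * fire (oddMass n h k 1 m)) / 4 :=
  wedge_two_step_axis hh (2 * k) (2 * m + 1) (by omega)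

lemma evenMass_succ_interior (hh : h < 1) (k x m : ℕ) :
    evenMass n h (k + 1) (x + 1) (m + 1) = rest (evenMass n h k (x + 1) (m + 1)) +
      (fire (oddMass n h k (x + 1) (m + 1)) + fire (oddMass n h k (x + 1) m) +
        fire (oddMass n h k (x + 2) m) + fire (oddMass n h k x (m + 1))) / 4 :=
  wedge_two_step_interior hh (2 * k) x (2 * m + 1) (by omega)

/-- The fourth neighbour is a mirror image on the axis and a genuine site elsewhere. In both cases
its level `y + 2 * l` is the same, and timing depends only on the level, so one argument covers both
cases. -/
lemma oddMass_succ (hh : h < 1) (k x m : ℕ) :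
    ∃ y l : ℕ, y + 2 * l = x + 2 * m + 1 ∧ m ≤ l ∧
      oddMass n h (k + 1) x m = rest (oddMass n h k x m) +
        (fire (evenMass n h (k + 1) x (m + 1)) + fire (evenMass n h (k + 1) x m) +
          fire (evenMass n h (k + 1) (x + 1) m) + fire (evenMass n h (k + 1) y l)) / 4 := by
  rcases x with _ | x
  · refine ⟨1, m, by omega, le_rfl, ?_⟩
    rw [oddMass_succ_axis hh]
    ring
  · exact ⟨x, m + 1, by omega, by omega, oddMass_succ_interior hh k x m⟩

lemma evenMass_succ (hh : h < 1) (k x m : ℕ) :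
    ∃ y l : ℕ, y + 2 * l = x + 2 * m + 1 ∧ m ≤ l ∧
      evenMass n h (k + 1) x (m + 1) = rest (evenMass n h k x (m + 1)) +
        (fire (oddMass n h k x (m + 1)) + fire (oddMass n h k x m) +
          fire (oddMass n h k (x + 1) m) + fire (oddMass n h k y l)) / 4 := by
  rcases x with _ | x
  · refine ⟨1, m, by omega, le_rfl, ?_⟩
    rw [evenMass_succ_axis hh]
    ring
  · exact ⟨x, m + 1, by omega, by omega, evenMass_succ_interior hh k x m⟩

/-- A rest is always below `1`, whatever the history of the site. This gives all bounds in the wake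
of the front. -/
lemma fire_rest_add_le (u : ℝ) {v : ℝ} (hv : 0 ≤ v) : fire (rest u + v) ≤ 1 + v := by
  have := rest_lt_one u
  unfold fire
  split_ifs <;> linarith

end Recursion

/-! ### Square growth for `n < 16 - 20 * h` -/

/-- The state at time `2k` of the wedge site `(x, 2m)`, in the square growth regime: the site
splits for the first time at time `2 * (x + 2 * m)`. -/
structure SquareEven (n h : ℝ) (k x m : ℕ) : Prop where
  far : k + 2 ≤ x + 2 * m → evenMass n h k x m = h
  pre : k + 1 = x + 2 * m → 0 < m → h + 1 / 4 ≤ evenMass n h k x m ∧ evenMass n h k x m < 1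
  preDiag : k + 1 = x → m = 0 → evenMass n h k x m = h
  first : k = x + 2 * m → 0 < x + m →
    4 - 4 * h ≤ evenMass n h k x m ∧ evenMass n h k x m ≤ 3 - 2 * h
  firstDiag : k = x → m = 0 → 0 < x → evenMass n h k x m ≤ 2 - h
  second : k = x + 2 * m + 1 → 0 < x + m → fire (evenMass n h k x m) = 0
  secondOrigin : k = 1 → x = 0 → m = 0 → fire (evenMass n h k x m) ≤ 4 - 4 * h
  third : k = x + 2 * m + 2 → fire (evenMass n h k x m) ≤ 24 / 5
  bound : x + 2 * m ≤ k + 2 → fire (evenMass n h k x m) ≤ 5 + 2 * ((k : ℝ) - (x + 2 * m))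

/-- The state at time `2k + 1` of the wedge site `(x, 2m + 1)`, in the square growth regime: the
site splits for the first time at time `2 * (x + 2 * m) + 1`. -/
structure SquareOdd (n h : ℝ) (k x m : ℕ) : Prop where
  far : k + 1 ≤ x + 2 * m → oddMass n h k x m = h
  first : k = x + 2 * m → 1 ≤ oddMass n h k x m ∧ oddMass n h k x m < 4 - 4 * h
  second : k = x + 2 * m + 1 → fire (oddMass n h k x m) = 0
  third : k = x + 2 * m + 2 → fire (oddMass n h k x m) ≤ 13 / 5
  bound : x + 2 * m ≤ k + 1 → fire (oddMass n h k x m) ≤ 4 + 2 * ((k : ℝ) - (x + 2 * m))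

section Square

variable {n h : ℝ}

lemma SquareEven.fire_eq_zero {k x m : ℕ} (H : SquareEven n h k x m) (hh : h < 1)
    (hk : k + 1 ≤ x + 2 * m) : fire (evenMass n h k x m) = 0 := by
  apply fire_of_lt
  rcases Nat.lt_or_ge (k + 1) (x + 2 * m) with h1 | h1
  · rw [H.far h1]; exact hh
  · rcases Nat.eq_zero_or_pos m with h2 | h2
    · rw [H.preDiag (by omega) h2]; exact hh
    · exact (H.pre (by omega) h2).2

lemma SquareOdd.fire_eq_zero {k x m : ℕ} (H : SquareOdd n h k x m) (hh : h < 1)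
    (hk : k + 1 ≤ x + 2 * m) : fire (oddMass n h k x m) = 0 := by
  rw [H.far hk]; exact fire_of_lt hh

lemma squareEven_zero (h0 : 7 / 10 ≤ h) (hh : h < 13 / 18) (hn : n ≤ 16 - 20 * h) (x m : ℕ) :
    SquareEven n h 0 x m := by
  have f0 : fire h = 0 := fire_of_lt (by linarith)
  rcases Nat.eq_zero_or_pos (x + m) with hz | hz
  · obtain ⟨rfl, rfl⟩ : x = 0 ∧ m = 0 := by omega
    refine ⟨by omega, by omega, by omega, by omega, by omega, by omega, by omega, by omega, ?_⟩
    intro _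
    rw [evenMass_zero_origin]
    unfold fire
    split_ifs <;> norm_num
    linarith
  · have e : evenMass n h 0 x m = h := evenMass_zero x m hz
    refine ⟨fun _ => e, by omega, fun _ _ => e, by omega, by omega, by omega, by omega, by omega,
      ?_⟩
    intro hx
    rw [e, f0]
    have : (x : ℝ) + 2 * m ≤ 2 := by exact_mod_cast hx
    push_cast
    linarith

lemma squareOdd_zero (h0 : 7 / 10 ≤ h) (hh : h < 13 / 18) (hn0 : 4 - 4 * h ≤ n)
    (hn : n < 16 - 20 * h) (x m : ℕ) : SquareOdd n h 0 x m := by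
  have h1 : h < 1 := by linarith
  rcases Nat.eq_zero_or_pos (x + m) with hz | hz
  · obtain ⟨rfl, rfl⟩ : x = 0 ∧ m = 0 := by omega
    have e : oddMass n h 0 0 0 = h + n / 4 := oddMass_zero_origin h1 (by linarith)
    have hf : 1 ≤ oddMass n h 0 0 0 := by rw [e]; linarith
    refine ⟨by omega, fun _ => ⟨hf, by rw [e]; linarith⟩, by omega, by omega, ?_⟩
    intro _
    rw [fire_of_le hf, e]
    norm_num
    linarith
  · have e : oddMass n h 0 x m = h := oddMass_zero h1 x m hz
    refine ⟨fun _ => e, by omega, by omega, by omega, ?_⟩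
    intro hx
    rw [e, fire_of_lt h1]
    have : (x : ℝ) + 2 * m ≤ 1 := by exact_mod_cast hx
    push_cast
    linarith

lemma squareOdd_succ (h0 : 7 / 10 ≤ h) (hh : h < 13 / 18) (k : ℕ)
    (hB : ∀ x m, SquareOdd n h k x m) (hA : ∀ x m, SquareEven n h (k + 1) x m) (x m : ℕ) :
    SquareOdd n h (k + 1) x m := by
  have h1 : h < 1 := by linarith
  obtain ⟨y, l, hy, -, e⟩ := oddMass_succ (n := n) h1 k x m
  have H := hB x m
  have Ha := hA x (m + 1)
  have Hb := hA x m
  have Ho := hA (x + 1) m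
  have Hi := hA y l
  have hyr : (y : ℝ) + 2 * l = x + 2 * m + 1 := by exact_mod_cast hy
  constructor
  · intro hk
    rw [e, H.far (by omega), rest_of_lt h1, Ha.fire_eq_zero h1 (by omega),
      Hb.fire_eq_zero h1 (by omega), Ho.fire_eq_zero h1 (by omega), Hi.fire_eq_zero h1 (by omega)]
    ring
  · intro hk
    -- A quarter of `4 - 4 * h` lifts `h` to `1`. The upper bound `h + (3 - 2 * h) / 4 < 4 - 4 * h`,
    -- which keeps this wave light, is equivalent to `h < 13 / 18`.
    have hb := Hb.first hk (by omega)
    rw [e, H.far (by omega), rest_of_lt h1, Ha.fire_eq_zero h1 (by omega),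
      fire_of_le (by linarith [hb.1]), Ho.fire_eq_zero h1 (by omega),
      Hi.fire_eq_zero h1 (by omega)]
    constructor <;> linarith
  · intro hk
    apply fire_of_lt
    have ho := Ho.first (by omega) (by omega)
    have hi := Hi.first (by omega) (by omega)
    rw [e, rest_of_le (H.first (by omega)).1, Ha.fire_eq_zero h1 (by omega),
      fire_of_le (v := evenMass n h (k + 1) (x + 1) m) (by linarith [ho.1]),
      fire_of_le (v := evenMass n h (k + 1) y l) (by linarith [hi.1])]
    -- The origin is not silent at time `2`; there the sharper diagonal bound gives `(4 - 4 * h + 2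
    -- * (2 - h)) / 4 < 1`. Everywhere else the inner neighbour is silent.
    rcases Nat.eq_zero_or_pos (x + m) with hz | hz
    · obtain ⟨rfl, rfl⟩ : x = 0 ∧ m = 0 := by omega
      obtain ⟨rfl, rfl⟩ : y = 1 ∧ l = 0 := by omega
      have := Hb.secondOrigin (by omega) rfl rfl
      have := Ho.firstDiag (by omega) rfl (by omega)
      have := Hi.firstDiag (by omega) rfl (by omega)
      linarith
    · rw [Hb.second (by omega) hz]
      linarith [ho.2, hi.2]
  · intro hk
    -- The closing inequality `1 + (3 - 2 * h + 24 / 5) / 4 ≤ 13 / 5` is equivalent to `7 / 10 ≤ h`.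
    have ha := Ha.first (by omega) (by omega)
    have hb := Hb.third (by omega)
    rw [e, Ho.second (by omega) (by omega), Hi.second (by omega) (by omega)]
    have h2 := fire_nonneg (evenMass n h (k + 1) x (m + 1))
    have h3 := fire_nonneg (evenMass n h (k + 1) x m)
    refine (fire_rest_add_le _ (by positivity)).trans ?_
    rw [fire_of_le (by linarith [ha.1])]
    linarith [ha.2]
  · intro hk
    have hkr : (x : ℝ) + 2 * m ≤ k + 1 + 1 := by exact_mod_cast hk
    rcases Nat.lt_or_ge (k + 1) (x + 2 * m) with hlt | hge
    · rw [e, H.far (by omega), rest_of_lt h1, Ha.fire_eq_zero h1 (by omega),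
        Hb.fire_eq_zero h1 (by omega), Ho.fire_eq_zero h1 (by omega),
        Hi.fire_eq_zero h1 (by omega), fire_of_lt (by linarith)]
      push_cast
      linarith
    -- The neighbours' levels average one more than the level here, so their bounds average `3 + 2 *
    -- (k + 1 - (x + 2 * m))`, and the rest adds less than `1`.
    · have ha := Ha.bound (by omega)
      have hb := Hb.bound (by omega)
      have ho := Ho.bound (by omega)
      have hi := Hi.bound (by omega)
      have h2 := fire_nonneg (evenMass n h (k + 1) x (m + 1))
      have h3 := fire_nonneg (evenMass n h (k + 1) x m)
      have h4 := fire_nonneg (evenMass n h (k + 1) (x + 1) m)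
      have h5 := fire_nonneg (evenMass n h (k + 1) y l)
      rw [e]
      refine (fire_rest_add_le _ (by positivity)).trans ?_
      push_cast at ha hb ho hi ⊢
      linarith

lemma squareEven_succ_diagonal (h0 : 7 / 10 ≤ h) (hh : h < 13 / 18) (k x : ℕ)
    (hA : ∀ x m, SquareEven n h k x m) (hB : ∀ x m, SquareOdd n h k x m) :
    SquareEven n h (k + 1) (x + 1) 0 := by
  have h1 : h < 1 := by linarith
  have e := evenMass_succ_diagonal (n := n) h1 k x
  have H := hA (x + 1) 0
  have Ha := hB (x + 1) 0
  have Hb := hB x 0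
  have hf : k + 1 < x + 1 → evenMass n h (k + 1) (x + 1) 0 = h := by
    intro hk
    rw [e, H.far (by omega), rest_of_lt h1, Ha.fire_eq_zero h1 (by omega),
      Hb.fire_eq_zero h1 (by omega)]
    ring
  -- Two mirror-image neighbours feed a diagonal site, so one light wave suffices. The resulting `h
  -- + 1 / 2` must be heavy: `h + 1 / 2 ≥ 4 - 4 * h` means `7 / 10 ≤ h`.
  have hd : k = x → h + 1 / 2 ≤ evenMass n h (k + 1) (x + 1) 0 ∧
      evenMass n h (k + 1) (x + 1) 0 ≤ 2 - h := by
    intro hk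
    have hb := Hb.first (by omega)
    rw [e, H.preDiag (by omega) rfl, rest_of_lt h1, Ha.fire_eq_zero h1 (by omega),
      fire_of_le hb.1]
    constructor <;> linarith
  have h2 := fire_nonneg (oddMass n h k (x + 1) 0)
  have h3 := fire_nonneg (oddMass n h k x 0)
  refine ⟨fun hk => hf (by omega), by omega, fun hk _ => hf (by omega), ?_, ?_, ?_, by omega, ?_,
    ?_⟩
  · intro hk _
    have := hd (by omega)
    constructor <;> linarith
  · intro hk _ _
    exact (hd (by omega)).2
  · intro hk _
    apply fire_of_lt
    have ha := Ha.first (by omega)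
    rw [e, rest_of_le (by linarith [(H.first (by omega) (by omega)).1]), fire_of_le ha.1,
      Hb.second (by omega)]
    linarith [ha.2]
  · intro hk
    have hb := Hb.third (by omega)
    rw [e, Ha.second (by omega)]
    refine (fire_rest_add_le _ (by positivity)).trans ?_
    linarith
  · intro hk
    have hkr : (x : ℝ) + 1 ≤ k + 1 + 2 := by exact_mod_cast hk
    rcases Nat.lt_or_ge (k + 1) (x + 1) with hlt | hge
    · rw [hf hlt, fire_of_lt h1]
      push_cast
      linarith
    · have ha := Ha.bound (by omega)
      have hb := Hb.bound (by omega)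
      rw [e]
      refine (fire_rest_add_le _ (by positivity)).trans ?_
      push_cast at ha hb ⊢
      linarith

lemma squareEven_succ_origin (h0 : 7 / 10 ≤ h) (hh : h < 13 / 18) (hn : 1 ≤ n) (k : ℕ)
    (hB : ∀ x m, SquareOdd n h k x m) :
    SquareEven n h (k + 1) 0 0 := by
  have h1 : h < 1 := by linarith
  have e := evenMass_succ_origin (n := n) h1 k
  have H := hB 0 0
  have h2 := fire_nonneg (oddMass n h k 0 0)
  refine ⟨by omega, by omega, by omega, by omega, by omega, by omega, ?_, ?_, ?_⟩
  · intro hk _ _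
    obtain rfl : k = 0 := by omega
    have hb := H.first rfl
    rw [e, evenMass_zero_origin, rest_of_le hn, zero_add, fire_of_le hb.1, fire_of_le hb.1]
    exact hb.2.le
  · intro hk
    rw [e, H.second (by omega)]
    exact (fire_rest_add_le _ le_rfl).trans (by norm_num)
  · intro _
    have hb := H.bound (by omega)
    rw [e]
    refine (fire_rest_add_le _ h2).trans ?_
    push_cast at hb ⊢
    linarith

lemma squareEven_succ_interior (h0 : 7 / 10 ≤ h) (hh : h < 13 / 18) (k x m : ℕ)
    (hA : ∀ x m, SquareEven n h k x m) (hB : ∀ x m, SquareOdd n h k x m) :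
    SquareEven n h (k + 1) x (m + 1) := by
  have h1 : h < 1 := by linarith
  obtain ⟨y, l, hy, -, e⟩ := evenMass_succ (n := n) h1 k x m
  have H := hA x (m + 1)
  have Ha := hB x (m + 1)
  have Hb := hB x m
  have Ho := hB (x + 1) m
  have Hi := hB y l
  have hyr : (y : ℝ) + 2 * l = x + 2 * m + 1 := by exact_mod_cast hy
  have hf : k + 3 ≤ x + 2 * (m + 1) → evenMass n h (k + 1) x (m + 1) = h := by
    intro hk
    rw [e, H.far (by omega), rest_of_lt h1, Ha.fire_eq_zero h1 (by omega),
      Hb.fire_eq_zero h1 (by omega), Ho.fire_eq_zero h1 (by omega), Hi.fire_eq_zero h1 (by omega)]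
    ring
  have hp : k + 2 = x + 2 * (m + 1) → h + 1 / 4 ≤ evenMass n h (k + 1) x (m + 1) ∧
      evenMass n h (k + 1) x (m + 1) < 1 := by
    intro hk
    have hb := Hb.first (by omega)
    rw [e, H.far (by omega), rest_of_lt h1, Ha.fire_eq_zero h1 (by omega), fire_of_le hb.1,
      Ho.fire_eq_zero h1 (by omega), Hi.fire_eq_zero h1 (by omega)]
    constructor <;> linarith
  have h2 := fire_nonneg (oddMass n h k x (m + 1))
  have h3 := fire_nonneg (oddMass n h k x m)
  have h4 := fire_nonneg (oddMass n h k (x + 1) m)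
  have h5 := fire_nonneg (oddMass n h k y l)
  refine ⟨fun hk => hf (by omega), fun hk _ => hp (by omega), by omega, ?_, by omega, ?_,
    by omega, ?_, ?_⟩
  · intro hk _
    have hr := H.pre (by omega) (by omega)
    have ho := Ho.first (by omega)
    have hi := Hi.first (by omega)
    rw [e, rest_of_lt hr.2, Ha.fire_eq_zero h1 (by omega), Hb.second (by omega),
      fire_of_le ho.1, fire_of_le hi.1]
    constructor <;> linarith
  · intro hk _
    apply fire_of_lt
    have ha := Ha.first (by omega)
    have hb := Hb.third (by omega)
    rw [e, rest_of_le (by linarith [(H.first (by omega) (by omega)).1]), fire_of_le ha.1,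
      Ho.second (by omega), Hi.second (by omega)]
    linarith [ha.2]
  · intro hk
    -- The inner neighbour is three rounds past its first splitting, so its bound is `4 + 2 * 3 =
    -- 10`, and `1 + (10 + 2 * (13 / 5)) / 4 = 24 / 5`.
    have hb := Hb.bound (by omega)
    have ho := Ho.third (by omega)
    have hi := Hi.third (by omega)
    have hkr : (k : ℝ) + 1 = x + 2 * (m + 1) + 2 := by exact_mod_cast hk
    rw [e, Ha.second (by omega)]
    refine (fire_rest_add_le _ (by positivity)).trans ?_
    linarith
  · intro hk
    have hkr : (x : ℝ) + 2 * (m + 1) ≤ k + 1 + 2 := by exact_mod_cast hk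
    rcases Nat.lt_or_ge (k + 1) (x + 2 * (m + 1)) with hlt | hge
    · have : fire (evenMass n h (k + 1) x (m + 1)) = 0 := by
        apply fire_of_lt
        rcases Nat.lt_or_ge (k + 2) (x + 2 * (m + 1)) with h6 | h6
        · rw [hf h6]; exact h1
        · exact (hp (by omega)).2
      rw [this]
      push_cast
      linarith
    · have ha := Ha.bound (by omega)
      have hb := Hb.bound (by omega)
      have ho := Ho.bound (by omega)
      have hi := Hi.bound (by omega)
      rw [e]
      refine (fire_rest_add_le _ (by positivity)).trans ?_
      push_cast at ha hb ho hi ⊢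
      linarith

lemma square_states (h0 : 7 / 10 ≤ h) (hh : h < 13 / 18) (hn0 : 4 - 4 * h ≤ n)
    (hn : n < 16 - 20 * h) (k : ℕ) :
    (∀ x m, SquareEven n h k x m) ∧ ∀ x m, SquareOdd n h k x m := by
  induction k with
  | zero => exact ⟨squareEven_zero h0 hh hn.le, squareOdd_zero h0 hh hn0 hn⟩
  | succ k ih =>
    have hA : ∀ x m, SquareEven n h (k + 1) x m := by
      intro x m
      rcases m with _ | m
      · rcases x with _ | x
        · exact squareEven_succ_origin h0 hh (by linarith) k ih.2
        · exact squareEven_succ_diagonal h0 hh k x ih.1 ih.2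
      · exact squareEven_succ_interior h0 hh k x m ih.1 ih.2
    exact ⟨hA, squareOdd_succ h0 hh k ih.2 hA⟩

/-- `τ` gives the time of the first splitting of each wedge site. -/
def IsFirstSplit (n h : ℝ) (τ : ℕ → ℕ → ℕ) : Prop :=
  ∀ x j, 1 ≤ wedge n h (τ x j) x j ∧ ∀ t < τ x j, wedge n h t x j < 1

lemma isFirstSplit_square (h0 : 7 / 10 ≤ h) (hh : h < 13 / 18) (hn0 : 4 - 4 * h ≤ n)
    (hn : n < 16 - 20 * h) :
    IsFirstSplit n h (fun x j => 2 * (x + j) - j % 2) := by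
  have h1 : h < 1 := by linarith
  intro x j
  rcases Nat.even_or_odd' j with ⟨m, rfl | rfl⟩
  · have e : 2 * (x + 2 * m) - 2 * m % 2 = 2 * (x + 2 * m) := by omega
    simp only [e]
    constructor
    · rcases Nat.eq_zero_or_pos (x + m) with hz | hz
      · obtain ⟨rfl, rfl⟩ : x = 0 ∧ m = 0 := by omega
        rw [Nat.mul_zero, wedge_zero_zero]
        linarith
      · have := (((square_states h0 hh hn0 hn (x + 2 * m)).1 x m).first rfl hz).1
        unfold evenMass at this
        linarith
    · intro t ht
      rcases Nat.even_or_odd' t with ⟨k, rfl | rfl⟩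
      · by_contra hc
        have := ((square_states h0 hh hn0 hn k).1 x m).fire_eq_zero h1 (by omega)
        rw [evenMass, fire_of_le (not_lt.mp hc)] at this
        linarith
      · exact wedge_lt_one_of_odd h1 _ _ _ (by omega)
  · have e : 2 * (x + (2 * m + 1)) - (2 * m + 1) % 2 = 2 * (x + 2 * m) + 1 := by omega
    simp only [e]
    refine ⟨(((square_states h0 hh hn0 hn (x + 2 * m)).2 x m).first rfl).1, ?_⟩
    intro t ht
    rcases Nat.even_or_odd' t with ⟨k, rfl | rfl⟩
    · exact wedge_lt_one_of_odd h1 _ _ _ (by omega)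
    · have := ((square_states h0 hh hn0 hn k).2 x m).far (by omega)
      rw [oddMass] at this
      rw [this]
      exact h1

end Square

/-! ### Square growth in the critical case `n = 16 - 20 * h` -/

/-- The state at time `2k` of the diagonal wedge site `(x, 0)`, for `n = 16 - 20 * h`: the site
splits for the first time at time `2 * x`. -/
structure CriticalDiag (n h : ℝ) (k x : ℕ) : Prop where
  far : k < x → evenMass n h k x 0 = h
  first : k = x → 0 < x → 1 ≤ evenMass n h k x 0 ∧ evenMass n h k x 0 ≤ 3 / 2
  firstOne : k = x → x = 1 → evenMass n h k x 0 ≤ 2 - h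
  second : k = x + 1 → 2 ≤ x → fire (evenMass n h k x 0) = 0
  secondOne : k = x + 1 → 1 ≤ x → fire (evenMass n h k x 0) ≤ 5 / 4
  secondOrigin : k = 1 → x = 0 → fire (evenMass n h k x 0) ≤ 4 - 4 * h
  bound : x ≤ k + 2 → fire (evenMass n h k x 0) ≤ 5 + 2 * ((k : ℝ) - x)

/-- The state at time `2k` of the wedge site `(x, 2m + 2)`, for `n = 16 - 20 * h`: the site splits
for the first time at time `2 * (x + 2 * m + 1)`. -/
structure CriticalEven (n h : ℝ) (k x m : ℕ) : Prop where
  far : k < x + 2 * m + 1 → evenMass n h k x (m + 1) = h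
  first : k = x + 2 * m + 1 →
    1 ≤ evenMass n h k x (m + 1) ∧ evenMass n h k x (m + 1) < 4 - 4 * h
  firstOrigin : k = 1 → x = 0 → m = 0 → evenMass n h k x (m + 1) ≤ 1
  second : k = x + 2 * m + 2 → fire (evenMass n h k x (m + 1)) = 0
  third : k = x + 2 * m + 3 → fire (evenMass n h k x (m + 1)) ≤ 13 / 5
  bound : x + 2 * m + 1 ≤ k + 1 →
    fire (evenMass n h k x (m + 1)) ≤ 3 + 2 * ((k : ℝ) - (x + 2 * m + 1))

/-- The state at time `2k + 1` of the wedge site `(x, 2m + 1)`, for `n = 16 - 20 * h`: the site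
splits for the first time at time `2 * (x + 2 * m) + 1`. -/
structure CriticalOdd (n h : ℝ) (k x m : ℕ) : Prop where
  far : k + 2 ≤ x + 2 * m → oddMass n h k x m = h
  pre : k + 1 = x + 2 * m → 0 < m → h + 1 / 4 ≤ oddMass n h k x m ∧ oddMass n h k x m < 1
  preDiag : k + 1 = x → m = 0 → oddMass n h k x m = h
  first : k = x + 2 * m → 4 - 4 * h ≤ oddMass n h k x m ∧ oddMass n h k x m ≤ 3 - 2 * h
  firstOrigin : k = 0 → x = 0 → m = 0 → oddMass n h k x m ≤ 4 - 4 * h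
  firstOne : k = 1 → x = 1 → m = 0 → oddMass n h k x m ≤ 3 / 4 + 3 / 4 * h
  second : k = x + 2 * m + 1 → 0 < x + m → fire (oddMass n h k x m) = 0
  secondOrigin : k = 1 → x = 0 → m = 0 → fire (oddMass n h k x m) ≤ (9 - 6 * h) / 4
  third : k = x + 2 * m + 2 → fire (oddMass n h k x m) ≤ 23 / 5
  bound : x + 2 * m ≤ k + 2 → fire (oddMass n h k x m) ≤ 4 + 2 * ((k : ℝ) - (x + 2 * m))

section Critical

variable {n h : ℝ}

lemma CriticalDiag.fire_eq_zero {k x : ℕ} (H : CriticalDiag n h k x) (hh : h < 1) (hk : k < x) :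
    fire (evenMass n h k x 0) = 0 := by
  rw [H.far hk]; exact fire_of_lt hh

lemma CriticalEven.fire_eq_zero {k x m : ℕ} (H : CriticalEven n h k x m) (hh : h < 1)
    (hk : k < x + 2 * m + 1) : fire (evenMass n h k x (m + 1)) = 0 := by
  rw [H.far hk]; exact fire_of_lt hh

lemma CriticalOdd.fire_eq_zero {k x m : ℕ} (H : CriticalOdd n h k x m) (hh : h < 1)
    (hk : k + 1 ≤ x + 2 * m) : fire (oddMass n h k x m) = 0 := by
  apply fire_of_lt
  rcases Nat.lt_or_ge (k + 1) (x + 2 * m) with h1 | h1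
  · rw [H.far h1]; exact hh
  · rcases Nat.eq_zero_or_pos m with h2 | h2
    · rw [H.preDiag (by omega) h2]; exact hh
    · exact (H.pre (by omega) h2).2

lemma criticalDiag_zero (h0 : 7 / 10 ≤ h) (hh : h < 13 / 18) (hn : n = 16 - 20 * h) (x : ℕ) :
    CriticalDiag n h 0 x := by
  rcases Nat.eq_zero_or_pos x with rfl | hz
  · refine ⟨by omega, by omega, by omega, by omega, by omega, by omega, ?_⟩
    intro _
    rw [evenMass_zero_origin, fire_of_le (by linarith)]
    norm_num
    linarith
  · have e : evenMass n h 0 x 0 = h := evenMass_zero x 0 hz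
    refine ⟨fun _ => e, by omega, by omega, by omega, by omega, by omega, ?_⟩
    intro hx
    rw [e, fire_of_lt (by linarith)]
    have : (x : ℝ) ≤ 2 := by exact_mod_cast hx
    push_cast
    linarith

lemma criticalEven_zero (h0 : 7 / 10 ≤ h) (hh : h < 13 / 18) (x m : ℕ) :
    CriticalEven n h 0 x m := by
  have e : evenMass n h 0 x (m + 1) = h := evenMass_zero x (m + 1) (by omega)
  refine ⟨fun _ => e, by omega, by omega, by omega, by omega, ?_⟩
  intro hx
  rw [e, fire_of_lt (by linarith)]
  have : (x : ℝ) + 2 * m + 1 ≤ 1 := by exact_mod_cast hx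
  push_cast
  linarith

lemma criticalOdd_zero (h0 : 7 / 10 ≤ h) (hh : h < 13 / 18) (hn : n = 16 - 20 * h) (x m : ℕ) :
    CriticalOdd n h 0 x m := by
  have h1 : h < 1 := by linarith
  rcases Nat.eq_zero_or_pos (x + m) with hz | hz
  · obtain ⟨rfl, rfl⟩ : x = 0 ∧ m = 0 := by omega
    -- The site `(0, 1)` is exactly heavy, so `(0, 2)` reaches exactly `1` and splits at time `2`
    -- instead of `4`. This exchanges the roles of the two parities off the diagonal.
    have e : oddMass n h 0 0 0 = 4 - 4 * h := by
      rw [oddMass_zero_origin h1 (by linarith), hn]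
      ring
    refine ⟨by omega, by omega, by omega, fun _ => ⟨e.ge, by linarith⟩, fun _ _ _ => e.le,
      by omega, by omega, by omega, by omega, ?_⟩
    intro _
    rw [fire_of_le (by linarith), e]
    norm_num
    linarith
  · have e : oddMass n h 0 x m = h := oddMass_zero h1 x m hz
    refine ⟨fun _ => e, by omega, fun _ _ => e, by omega, by omega, by omega, by omega, by omega,
      by omega, ?_⟩
    intro hx
    rw [e, fire_of_lt h1]
    have : (x : ℝ) + 2 * m ≤ 2 := by exact_mod_cast hx
    push_cast
    linarith

lemma criticalDiag_succ_origin (h0 : 7 / 10 ≤ h) (hh : h < 13 / 18) (hn : 1 ≤ n) (k : ℕ)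
    (hB : ∀ x m, CriticalOdd n h k x m) : CriticalDiag n h (k + 1) 0 := by
  have h1 : h < 1 := by linarith
  have e := evenMass_succ_origin (n := n) h1 k
  have H := hB 0 0
  refine ⟨by omega, by omega, by omega, by omega, by omega, ?_, ?_⟩
  · intro hk _
    obtain rfl : k = 0 := by omega
    have hb := H.first rfl
    have hb' := H.firstOrigin rfl rfl rfl
    have hb1 : 1 ≤ oddMass n h 0 0 0 := by linarith
    rw [e, evenMass_zero_origin, rest_of_le hn, zero_add, fire_of_le hb1, fire_of_le hb1]
    exact hb'
  · intro _
    have hb := H.bound (by omega)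
    rw [e]
    refine (fire_rest_add_le _ (fire_nonneg _)).trans ?_
    push_cast at hb ⊢
    linarith

lemma criticalDiag_succ (h0 : 7 / 10 ≤ h) (hh : h < 13 / 18) (k x : ℕ)
    (hC : ∀ x, CriticalDiag n h k x) (hB : ∀ x m, CriticalOdd n h k x m) :
    CriticalDiag n h (k + 1) (x + 1) := by
  have h1 : h < 1 := by linarith
  have e := evenMass_succ_diagonal (n := n) h1 k x
  have H := hC (x + 1)
  have Ha := hB (x + 1) 0
  have Hb := hB x 0
  have hf : k + 1 < x + 1 → evenMass n h (k + 1) (x + 1) 0 = h := by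
    intro hk
    rw [e, H.far (by omega), rest_of_lt h1, Ha.fire_eq_zero h1 (by omega),
      Hb.fire_eq_zero h1 (by omega)]
    ring
  have hd : k = x → evenMass n h (k + 1) (x + 1) 0 = h + oddMass n h k x 0 / 2 := by
    intro hk
    have hb := Hb.first (by omega)
    rw [e, H.far (by omega), rest_of_lt h1, Ha.fire_eq_zero h1 (by omega),
      fire_of_le (by linarith)]
    ring
  have hs : k = x + 1 → evenMass n h (k + 1) (x + 1) 0 =
      (oddMass n h k (x + 1) 0 + fire (oddMass n h k x 0)) / 2 := by
    intro hk
    have ha := Ha.first (by omega)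
    rw [e, rest_of_le (H.first (by omega) (by omega)).1,
      fire_of_le (v := oddMass n h k (x + 1) 0) (by linarith)]
    ring
  have h2 := fire_nonneg (oddMass n h k (x + 1) 0)
  have h3 := fire_nonneg (oddMass n h k x 0)
  refine ⟨hf, ?_, ?_, ?_, ?_, by omega, ?_⟩
  · intro hk _
    have hb := Hb.first (by omega)
    rw [hd (by omega)]
    constructor <;> linarith
  · intro hk hx
    have hb := Hb.firstOrigin (by omega) (by omega) rfl
    rw [hd (by omega)]
    linarith
  · intro hk hx
    apply fire_of_lt
    have ha := Ha.first (by omega)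
    rw [hs (by omega), Hb.second (by omega) (by omega)]
    linarith [ha.2]
  · intro hk _
    have ha := Ha.first (by omega)
    have : evenMass n h (k + 1) (x + 1) 0 ≤ 5 / 4 := by
      rw [hs (by omega)]
      -- The site `(0, 1)` may split in two consecutive rounds, so `(1, 1)` may as well; only later
      -- diagonal sites are sure to be silent in the second round.
      rcases Nat.eq_zero_or_pos x with rfl | hx
      · have hb := Hb.secondOrigin (by omega) rfl rfl
        have ha' := Ha.firstOne (by omega) (by omega) rfl
        linarith
      · rw [Hb.second (by omega) (by omega)]
        linarith [ha.2]
    unfold fire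
    split_ifs <;> linarith
  · intro hk
    have hkr : (x : ℝ) + 1 ≤ k + 1 + 2 := by exact_mod_cast hk
    rcases Nat.lt_or_ge (k + 1) (x + 1) with hlt | hge
    · rw [hf hlt, fire_of_lt h1]
      push_cast
      linarith
    · have ha := Ha.bound (by omega)
      have hb := Hb.bound (by omega)
      rw [e]
      refine (fire_rest_add_le _ (by positivity)).trans ?_
      push_cast at ha hb ⊢
      linarith

lemma criticalEven_succ (h0 : 7 / 10 ≤ h) (hh : h < 13 / 18) (k x m : ℕ)
    (hA : ∀ x m, CriticalEven n h k x m) (hB : ∀ x m, CriticalOdd n h k x m) :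
    CriticalEven n h (k + 1) x m := by
  have h1 : h < 1 := by linarith
  obtain ⟨y, l, hy, -, e⟩ := evenMass_succ (n := n) h1 k x m
  have H := hA x m
  have Ha := hB x (m + 1)
  have Hb := hB x m
  have Ho := hB (x + 1) m
  have Hi := hB y l
  have hyr : (y : ℝ) + 2 * l = x + 2 * m + 1 := by exact_mod_cast hy
  have hf : k + 1 < x + 2 * m + 1 → evenMass n h (k + 1) x (m + 1) = h := by
    intro hk
    rw [e, H.far (by omega), rest_of_lt h1, Ha.fire_eq_zero h1 (by omega),
      Hb.fire_eq_zero h1 (by omega), Ho.fire_eq_zero h1 (by omega), Hi.fire_eq_zero h1 (by omega)]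
    ring
  have hd : k = x + 2 * m → evenMass n h (k + 1) x (m + 1) = h + oddMass n h k x m / 4 := by
    intro hk
    have hb := Hb.first hk
    rw [e, H.far (by omega), rest_of_lt h1, Ha.fire_eq_zero h1 (by omega),
      fire_of_le (by linarith), Ho.fire_eq_zero h1 (by omega), Hi.fire_eq_zero h1 (by omega)]
    ring
  have h2 := fire_nonneg (oddMass n h k x (m + 1))
  have h3 := fire_nonneg (oddMass n h k x m)
  have h4 := fire_nonneg (oddMass n h k (x + 1) m)
  have h5 := fire_nonneg (oddMass n h k y l)
  refine ⟨hf, ?_, ?_, ?_, ?_, ?_⟩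
  · intro hk
    have hb := Hb.first (by omega)
    rw [hd (by omega)]
    constructor <;> linarith
  · intro hk hx hm
    have hb := Hb.firstOrigin (by omega) hx hm
    rw [hd (by omega)]
    linarith
  · intro hk
    apply fire_of_lt
    have ho := Ho.first (by omega)
    have hi := Hi.first (by omega)
    rw [e, rest_of_le (H.first (by omega)).1, Ha.fire_eq_zero h1 (by omega),
      fire_of_le (v := oddMass n h k (x + 1) m) (by linarith),
      fire_of_le (v := oddMass n h k y l) (by linarith)]
    -- Next to the origin the generic bound `3 - 2 * h` is too weak. With the sharp first values the
    -- terms in `h` cancel: `(9 - 6 * h) / 4 + 2 * (3 / 4 + 3 / 4 * h) = 15 / 4 < 4`.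
    rcases Nat.eq_zero_or_pos (x + m) with hz | hz
    · obtain ⟨rfl, rfl⟩ : x = 0 ∧ m = 0 := by omega
      obtain ⟨rfl, rfl⟩ : y = 1 ∧ l = 0 := by omega
      have := Hb.secondOrigin (by omega) rfl rfl
      have := Ho.firstOne (by omega) rfl rfl
      have := Hi.firstOne (by omega) rfl rfl
      linarith
    · rw [Hb.second (by omega) hz]
      linarith [ho.2, hi.2]
  · intro hk
    have ha := Ha.first (by omega)
    have hb := Hb.third (by omega)
    rw [e, Ho.second (by omega) (by omega), Hi.second (by omega) (by omega)]
    refine (fire_rest_add_le _ (by positivity)).trans ?_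
    rw [fire_of_le (v := oddMass n h k x (m + 1)) (by linarith)]
    linarith
  · intro hk
    have hkr : (x : ℝ) + 2 * m + 1 ≤ k + 1 + 1 := by exact_mod_cast hk
    rcases Nat.lt_or_ge (k + 1) (x + 2 * m + 1) with hlt | hge
    · rw [hf hlt, fire_of_lt h1]
      push_cast
      linarith
    · have ha := Ha.bound (by omega)
      have hb := Hb.bound (by omega)
      have ho := Ho.bound (by omega)
      have hi := Hi.bound (by omega)
      rw [e]
      refine (fire_rest_add_le _ (by positivity)).trans ?_
      push_cast at ha hb ho hi ⊢
      linarith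

lemma criticalOdd_succ_diagonal (h0 : 7 / 10 ≤ h) (hh : h < 13 / 18) (k x : ℕ)
    (hB : ∀ x m, CriticalOdd n h k x m) (hC : ∀ x, CriticalDiag n h (k + 1) x)
    (hA : ∀ x m, CriticalEven n h (k + 1) x m) :
    CriticalOdd n h (k + 1) (x + 1) 0 := by
  have h1 : h < 1 := by linarith
  have e := oddMass_succ_interior (n := n) h1 k x 0
  have H := hB (x + 1) 0
  have Ha := hA (x + 1) 0
  have Hb := hC (x + 1)
  have Ho := hC (x + 2)
  have Hi := hA x 0
  have hf : k + 1 < x + 1 → oddMass n h (k + 1) (x + 1) 0 = h := by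
    intro hk
    have hr : oddMass n h k (x + 1) 0 = h := H.far (by omega)
    rw [e, hr, rest_of_lt h1, Ha.fire_eq_zero h1 (by omega),
      Hb.fire_eq_zero h1 (by omega), Ho.fire_eq_zero h1 (by omega), Hi.fire_eq_zero h1 (by omega)]
    ring
  -- Two light neighbours, one of them on the diagonal, split for the first time together. Again `h
  -- + 1 / 2 ≥ 4 - 4 * h` uses `7 / 10 ≤ h`.
  have hd : k = x → oddMass n h (k + 1) (x + 1) 0 =
      h + (evenMass n h (k + 1) (x + 1) 0 + evenMass n h (k + 1) x (0 + 1)) / 4 := by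
    intro hk
    rw [e, H.preDiag (by omega) rfl, rest_of_lt h1, Ha.fire_eq_zero h1 (by omega),
      Ho.fire_eq_zero h1 (by omega), fire_of_le (Hb.first (by omega) (by omega)).1,
      fire_of_le (Hi.first (by omega)).1]
    ring
  have h2 := fire_nonneg (evenMass n h (k + 1) (x + 1) (0 + 1))
  have h3 := fire_nonneg (evenMass n h (k + 1) (x + 1) 0)
  have h4 := fire_nonneg (evenMass n h (k + 1) (x + 2) 0)
  have h5 := fire_nonneg (evenMass n h (k + 1) x (0 + 1))
  refine ⟨fun hk => hf (by omega), by omega, fun hk _ => hf (by omega), ?_, by omega, ?_, ?_,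
    by omega, ?_, ?_⟩
  · intro hk
    have hb := Hb.first (by omega) (by omega)
    have hi := Hi.first (by omega)
    rw [hd (by omega)]
    constructor <;> linarith
  · intro hk hx _
    have hb := Hb.firstOne (by omega) (by omega)
    have hi := Hi.firstOrigin (by omega) (by omega) rfl
    rw [hd (by omega)]
    linarith
  · intro hk _
    apply fire_of_lt
    have ha := Ha.first (by omega)
    have hb := Hb.secondOne (by omega) (by omega)
    have ho := Ho.first (by omega) (by omega)
    have hr : rest (oddMass n h k (x + 1) 0) = 0 :=
      rest_of_le (by linarith [(H.first (by omega)).1])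
    rw [e, hr, fire_of_le ha.1, fire_of_le ho.1, Hi.second (by omega)]
    linarith
  · intro hk
    have hb := Hb.bound (by omega)
    have ho := Ho.secondOne (by omega) (by omega)
    have hi := Hi.third (by omega)
    have hkr : (k : ℝ) + 1 = x + 1 + 2 := by exact_mod_cast hk
    rw [e, Ha.second (by omega)]
    refine (fire_rest_add_le _ (by positivity)).trans ?_
    push_cast at hb
    linarith
  · intro hk
    have hkr : (x : ℝ) + 1 ≤ k + 1 + 2 := by exact_mod_cast hk
    rcases Nat.lt_or_ge (k + 1) (x + 1) with hlt | hge
    · rw [hf hlt, fire_of_lt h1]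
      push_cast
      linarith
    · have ha := Ha.bound (by omega)
      have hb := Hb.bound (by omega)
      have ho := Ho.bound (by omega)
      have hi := Hi.bound (by omega)
      rw [e]
      refine (fire_rest_add_le _ (by positivity)).trans ?_
      push_cast at ha hb ho hi ⊢
      linarith

lemma criticalOdd_succ_origin (h0 : 7 / 10 ≤ h) (hh : h < 13 / 18) (k : ℕ)
    (hB : ∀ x m, CriticalOdd n h k x m) (hC : ∀ x, CriticalDiag n h (k + 1) x)
    (hA : ∀ x m, CriticalEven n h (k + 1) x m) :
    CriticalOdd n h (k + 1) 0 0 := by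
  have h1 : h < 1 := by linarith
  have e := oddMass_succ_axis (n := n) h1 k 0
  have H := hB 0 0
  have Ha := hA 0 0
  have Hb := hC 0
  have Ho := hC 1
  have h2 := fire_nonneg (evenMass n h (k + 1) 0 (0 + 1))
  have h3 := fire_nonneg (evenMass n h (k + 1) 0 0)
  have h4 := fire_nonneg (evenMass n h (k + 1) 1 0)
  refine ⟨by omega, by omega, by omega, by omega, by omega, by omega, by omega, ?_, ?_, ?_⟩
  · intro hk _ _
    have ha := Ha.first (by omega)
    have ha' := Ha.firstOrigin (by omega) rfl rfl
    have hb := Hb.secondOrigin (by omega) rfl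
    have ho := Ho.first (by omega) (by omega)
    have ho' := Ho.firstOne (by omega) rfl
    rw [e, rest_of_le (by linarith [(H.first (by omega)).1]), fire_of_le ha.1, fire_of_le ho.1]
    unfold fire at *
    split_ifs at * <;> linarith
  · intro hk
    have hb := Hb.bound (by omega)
    have ho := Ho.secondOne (by omega) (by omega)
    have hkr : (k : ℝ) + 1 = 2 := by exact_mod_cast hk
    rw [e, Ha.second (by omega)]
    refine (fire_rest_add_le _ (by positivity)).trans ?_
    push_cast at hb
    linarith
  · intro hk
    have ha := Ha.bound (by omega)
    have hb := Hb.bound (by omega)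
    have ho := Ho.bound (by omega)
    rw [e]
    refine (fire_rest_add_le _ (by positivity)).trans ?_
    push_cast at ha hb ho ⊢
    linarith

lemma criticalOdd_succ_succ (h0 : 7 / 10 ≤ h) (hh : h < 13 / 18) (k x m : ℕ)
    (hB : ∀ x m, CriticalOdd n h k x m) (hA : ∀ x m, CriticalEven n h (k + 1) x m) :
    CriticalOdd n h (k + 1) x (m + 1) := by
  have h1 : h < 1 := by linarith
  obtain ⟨y, l, hy, hl, e⟩ := oddMass_succ (n := n) h1 k x (m + 1)
  -- The fourth neighbour lies off the diagonal, so `CriticalEven` applies to it.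
  obtain ⟨l, rfl⟩ : ∃ i, l = i + 1 := ⟨l - 1, by omega⟩
  have H := hB x (m + 1)
  have Ha := hA x (m + 1)
  have Hb := hA x m
  have Ho := hA (x + 1) m
  have Hi := hA y l
  have hyr : (y : ℝ) + 2 * (l + 1) = x + 2 * (m + 1) + 1 := by exact_mod_cast hy
  have hf : k + 3 ≤ x + 2 * (m + 1) → oddMass n h (k + 1) x (m + 1) = h := by
    intro hk
    rw [e, H.far (by omega), rest_of_lt h1, Ha.fire_eq_zero h1 (by omega),
      Hb.fire_eq_zero h1 (by omega), Ho.fire_eq_zero h1 (by omega), Hi.fire_eq_zero h1 (by omega)]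
    ring
  have hp : k + 2 = x + 2 * (m + 1) → h + 1 / 4 ≤ oddMass n h (k + 1) x (m + 1) ∧
      oddMass n h (k + 1) x (m + 1) < 1 := by
    intro hk
    have hb := Hb.first (by omega)
    rw [e, H.far (by omega), rest_of_lt h1, Ha.fire_eq_zero h1 (by omega), fire_of_le hb.1,
      Ho.fire_eq_zero h1 (by omega), Hi.fire_eq_zero h1 (by omega)]
    constructor <;> linarith
  have h2 := fire_nonneg (evenMass n h (k + 1) x (m + 1 + 1))
  have h3 := fire_nonneg (evenMass n h (k + 1) x (m + 1))
  have h4 := fire_nonneg (evenMass n h (k + 1) (x + 1) (m + 1))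
  have h5 := fire_nonneg (evenMass n h (k + 1) y (l + 1))
  refine ⟨fun hk => hf (by omega), fun hk _ => hp (by omega), by omega, ?_, by omega, by omega, ?_,
    by omega, ?_, ?_⟩
  · intro hk
    have hr := H.pre (by omega) (by omega)
    have ho := Ho.first (by omega)
    have hi := Hi.first (by omega)
    rw [e, rest_of_lt hr.2, Ha.fire_eq_zero h1 (by omega), Hb.second (by omega),
      fire_of_le ho.1, fire_of_le hi.1]
    constructor <;> linarith
  · intro hk _
    apply fire_of_lt
    have ha := Ha.first (by omega)
    have hb := Hb.third (by omega)
    rw [e, rest_of_le (by linarith [(H.first (by omega)).1]), fire_of_le ha.1,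
      Ho.second (by omega), Hi.second (by omega)]
    linarith [ha.2]
  · intro hk
    have hb := Hb.bound (by omega)
    have ho := Ho.third (by omega)
    have hi := Hi.third (by omega)
    have hkr : (k : ℝ) + 1 = x + 2 * (m + 1) + 2 := by exact_mod_cast hk
    rw [e, Ha.second (by omega)]
    refine (fire_rest_add_le _ (by positivity)).trans ?_
    push_cast at hb
    linarith
  · intro hk
    have hkr : (x : ℝ) + 2 * (m + 1) ≤ k + 1 + 2 := by exact_mod_cast hk
    rcases Nat.lt_or_ge (k + 1) (x + 2 * (m + 1)) with hlt | hge
    · have : fire (oddMass n h (k + 1) x (m + 1)) = 0 := by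
        apply fire_of_lt
        rcases Nat.lt_or_ge (k + 2) (x + 2 * (m + 1)) with h6 | h6
        · rw [hf h6]; exact h1
        · exact (hp (by omega)).2
      rw [this]
      push_cast
      linarith
    · have ha := Ha.bound (by omega)
      have hb := Hb.bound (by omega)
      have ho := Ho.bound (by omega)
      have hi := Hi.bound (by omega)
      rw [e]
      refine (fire_rest_add_le _ (by positivity)).trans ?_
      push_cast at ha hb ho hi ⊢
      linarith

lemma critical_states (h0 : 7 / 10 ≤ h) (hh : h < 13 / 18) (hn : n = 16 - 20 * h) (k : ℕ) :
    (∀ x, CriticalDiag n h k x) ∧ (∀ x m, CriticalEven n h k x m) ∧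
      ∀ x m, CriticalOdd n h k x m := by
  induction k with
  | zero =>
    exact ⟨criticalDiag_zero h0 hh hn, criticalEven_zero h0 hh, criticalOdd_zero h0 hh hn⟩
  | succ k ih =>
    obtain ⟨ihC, ihA, ihB⟩ := ih
    have hC : ∀ x, CriticalDiag n h (k + 1) x := by
      intro x
      rcases x with _ | x
      · exact criticalDiag_succ_origin h0 hh (by linarith) k ihB
      · exact criticalDiag_succ h0 hh k x ihC ihB
    have hA : ∀ x m, CriticalEven n h (k + 1) x m :=
      fun x m => criticalEven_succ h0 hh k x m ihA ihB
    refine ⟨hC, hA, fun x m => ?_⟩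
    rcases m with _ | m
    · rcases x with _ | x
      · exact criticalOdd_succ_origin h0 hh k ihB hC hA
      · exact criticalOdd_succ_diagonal h0 hh k x ihB hC hA
    · exact criticalOdd_succ_succ h0 hh k x m ihB hA

/-- The time of the first splitting of the wedge site `(x, j)` for `n = 16 - 20 * h`. -/
def criticalTime (x j : ℕ) : ℕ :=
  if j = 0 then 2 * x else if j % 2 = 1 then 2 * (x + j) - 1 else 2 * (x + j) - 2

lemma isFirstSplit_critical (h0 : 7 / 10 ≤ h) (hh : h < 13 / 18) (hn : n = 16 - 20 * h) :
    IsFirstSplit n h criticalTime := by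
  have h1 : h < 1 := by linarith
  intro x j
  unfold criticalTime
  rcases Nat.even_or_odd' j with ⟨m, rfl | rfl⟩
  · rcases m with _ | m
    · simp only [Nat.mul_zero, ↓reduceIte]
      constructor
      · rcases Nat.eq_zero_or_pos x with rfl | hx
        · rw [Nat.mul_zero, wedge_zero_zero]
          linarith
        · exact (((critical_states h0 hh hn x).1 x).first rfl hx).1
      · intro t ht
        rcases Nat.even_or_odd' t with ⟨k, rfl | rfl⟩
        · have : evenMass n h k x 0 = h := ((critical_states h0 hh hn k).1 x).far (by omega)
          rw [evenMass] at this
          exact this.trans_lt h1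
        · exact wedge_lt_one_of_odd h1 _ _ _ (by omega)
    · have e : 2 * (x + 2 * (m + 1)) - 2 = 2 * (x + 2 * m + 1) := by omega
      rw [if_neg (by omega), if_neg (by omega), e]
      refine ⟨(((critical_states h0 hh hn (x + 2 * m + 1)).2.1 x m).first rfl).1, ?_⟩
      intro t ht
      rcases Nat.even_or_odd' t with ⟨k, rfl | rfl⟩
      · have := ((critical_states h0 hh hn k).2.1 x m).far (by omega)
        rw [evenMass] at this
        exact this.trans_lt h1
      · exact wedge_lt_one_of_odd h1 _ _ _ (by omega)
  · have e : 2 * (x + (2 * m + 1)) - 1 = 2 * (x + 2 * m) + 1 := by omega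
    rw [if_neg (by omega), if_pos (by omega), e]
    constructor
    · have := (((critical_states h0 hh hn (x + 2 * m)).2.2 x m).first rfl).1
      unfold oddMass at this
      linarith
    · intro t ht
      rcases Nat.even_or_odd' t with ⟨k, rfl | rfl⟩
      · exact wedge_lt_one_of_odd h1 _ _ _ (by omega)
      · by_contra hc
        have := ((critical_states h0 hh hn k).2.2 x m).fire_eq_zero h1 (by omega)
        rw [oddMass, fire_of_le (not_lt.mp hc)] at this
        linarith

end Critical

/-! ### Octagon growth -/

/-- The state at time `t` of the wedge site `(x, 3m)`, in the octagon growth regime: the site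
splits at the times `2 * x + 5 * m + 2 * i`. -/
structure OctagonZero (n h : ℝ) (t x m : ℕ) : Prop where
  far : t + 2 < 2 * x + 5 * m → wedge n h t x (3 * m) = h
  pre : t + 2 = 2 * x + 5 * m → 0 < m →
    h + 1 / 4 ≤ wedge n h t x (3 * m) ∧ wedge n h t x (3 * m) < 1
  preDiag : t < 2 * x → m = 0 → wedge n h t x (3 * m) = h
  first : t = 2 * x + 5 * m → 0 < m →
    h + 1 ≤ wedge n h t x (3 * m) ∧ wedge n h t x (3 * m) ≤ 53 / 25
  firstDiag : t = 2 * x → m = 0 → 0 < x →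
    h + 129 / 200 ≤ wedge n h t x (3 * m) ∧ wedge n h t x (3 * m) ≤ 53 / 25
  later : 2 * x + 5 * m < t → 1 ≤ wedge n h t x (3 * m) ∧ wedge n h t x (3 * m) ≤ 53 / 25

/-- The state at time `t` of the wedge site `(x, 3m + 1)`, in the octagon growth regime: the site
splits at the times `2 * x + 5 * m + 1 + 2 * i`. -/
structure OctagonOne (n h : ℝ) (t x m : ℕ) : Prop where
  far : t < 2 * x + 5 * m + 1 → wedge n h t x (3 * m + 1) = h
  first : t = 2 * x + 5 * m + 1 →
    4 - 4 * h ≤ wedge n h t x (3 * m + 1) ∧ wedge n h t x (3 * m + 1) ≤ 153 / 100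
  firstInterior : t = 2 * x + 5 * m + 1 → 0 < x → 0 < m →
    (5 * h + 2) / 4 ≤ wedge n h t x (3 * m + 1)
  firstDiag : t = 2 * x + 5 * m + 1 → 0 < x → m = 0 → 129 / 100 ≤ wedge n h t x (3 * m + 1)
  firstOrigin : t = 1 → x = 0 → m = 0 → 129 / 100 ≤ wedge n h t x (3 * m + 1)
  secondAxis : t = 5 * m + 3 → x = 0 → 0 < m → 13 / 10 ≤ wedge n h t x (3 * m + 1)
  later : 2 * x + 5 * m + 1 < t →
    1 ≤ wedge n h t x (3 * m + 1) ∧ wedge n h t x (3 * m + 1) ≤ 53 / 25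

/-- The state at time `t` of the wedge site `(x, 3m + 2)`, in the octagon growth regime: the site
splits at the times `2 * x + 5 * m + 2 + 2 * i`. -/
structure OctagonTwo (n h : ℝ) (t x m : ℕ) : Prop where
  far : t < 2 * x + 5 * m + 2 → wedge n h t x (3 * m + 2) = h
  first : t = 2 * x + 5 * m + 2 →
    1 ≤ wedge n h t x (3 * m + 2) ∧ wedge n h t x (3 * m + 2) ≤ h + 153 / 400
  second : t = 2 * x + 5 * m + 4 →
    1 ≤ wedge n h t x (3 * m + 2) ∧ wedge n h t x (3 * m + 2) ≤ 159 / 100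
  later : 2 * x + 5 * m + 2 < t →
    1 ≤ wedge n h t x (3 * m + 2) ∧ wedge n h t x (3 * m + 2) ≤ 53 / 25

/-- The state of all sites that can be unstable at time `t`, in the octagon growth regime. -/
structure OctagonState (n h : ℝ) (t : ℕ) : Prop where
  zero : ∀ x m, (t + m) % 2 = 0 → OctagonZero n h t x m
  one : ∀ x m, (t + m) % 2 = 1 → OctagonOne n h t x m
  two : ∀ x m, (t + m) % 2 = 0 → OctagonTwo n h t x m

section Octagon

variable {n h : ℝ}

lemma OctagonZero.fire_eq_zero {t x m : ℕ} (H : OctagonZero n h t x m) (hh : h < 1)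
    (ht : t < 2 * x + 5 * m) (hp : (t + m) % 2 = 0) : fire (wedge n h t x (3 * m)) = 0 := by
  apply fire_of_lt
  rcases Nat.eq_zero_or_pos m with hm | hm
  · rw [H.preDiag (by omega) hm]; exact hh
  · rcases Nat.lt_or_ge (t + 2) (2 * x + 5 * m) with h1 | h1
    · rw [H.far h1]; exact hh
    · exact (H.pre (by omega) hm).2

/-- The condition `0 < t` excludes the origin at time `0`, whose initial mass `3` exceeds `53 / 25`.
-/
lemma OctagonZero.fired {t x m : ℕ} (H : OctagonZero n h t x m) (h0 : 5 / 7 ≤ h) (ht0 : 0 < t)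
    (ht : 2 * x + 5 * m ≤ t) :
    1 ≤ wedge n h t x (3 * m) ∧ wedge n h t x (3 * m) ≤ 53 / 25 := by
  rcases ht.lt_or_eq with h1 | h1
  · exact H.later h1
  · rcases Nat.eq_zero_or_pos m with hm | hm
    · have := H.firstDiag (by omega) hm (by omega)
      exact ⟨by linarith, this.2⟩
    · have := H.first h1.symm hm
      exact ⟨by linarith, this.2⟩

lemma OctagonOne.fire_eq_zero {t x m : ℕ} (H : OctagonOne n h t x m) (hh : h < 1)
    (ht : t < 2 * x + 5 * m + 1) : fire (wedge n h t x (3 * m + 1)) = 0 := by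
  rw [H.far ht]; exact fire_of_lt hh

lemma OctagonOne.fired {t x m : ℕ} (H : OctagonOne n h t x m) (hh : h < 13 / 18)
    (ht : 2 * x + 5 * m + 1 ≤ t) :
    1 ≤ wedge n h t x (3 * m + 1) ∧ wedge n h t x (3 * m + 1) ≤ 53 / 25 := by
  rcases ht.lt_or_eq with h1 | h1
  · exact H.later h1
  · have := H.first h1.symm
    constructor <;> linarith

lemma OctagonTwo.fire_eq_zero {t x m : ℕ} (H : OctagonTwo n h t x m) (hh : h < 1)
    (ht : t < 2 * x + 5 * m + 2) : fire (wedge n h t x (3 * m + 2)) = 0 := by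
  rw [H.far ht]; exact fire_of_lt hh

lemma OctagonTwo.fired {t x m : ℕ} (H : OctagonTwo n h t x m) (hh : h < 13 / 18)
    (ht : 2 * x + 5 * m + 2 ≤ t) :
    1 ≤ wedge n h t x (3 * m + 2) ∧ wedge n h t x (3 * m + 2) ≤ 53 / 25 := by
  rcases ht.lt_or_eq with h1 | h1
  · exact H.later h1
  · have := H.first h1.symm
    constructor <;> linarith

lemma octagonState_zero : OctagonState n h 0 := by
  refine ⟨fun x m hp => ?_, fun x m hp => ?_, fun x m hp => ?_⟩
  · exact ⟨fun ht => wedge_zero_of_ne _ _ (by omega), by omega,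
      fun ht _ => wedge_zero_of_ne _ _ (by omega), by omega, by omega, by omega⟩
  · exact ⟨fun ht => wedge_zero_of_ne _ _ (by omega), by omega, by omega, by omega, by omega,
      by omega, by omega⟩
  · exact ⟨fun ht => wedge_zero_of_ne _ _ (by omega), by omega, by omega, by omega⟩

lemma octagonState_one (h0 : 5 / 7 ≤ h) (hh : h < 13 / 18) (hn : n = 3) : OctagonState n h 1 := by
  have h1 : h < 1 := by linarith
  refine ⟨fun x m hp => ?_, fun x m hp => ?_, fun x m hp => ?_⟩
  · have e : wedge n h 1 x (3 * m) = h := wedge_one_of_odd h1 _ _ (by omega) (by omega)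
    exact ⟨fun _ => e, by omega, fun _ _ => e, by omega, by omega, by omega⟩
  · rcases Nat.eq_zero_or_pos (x + m) with hz | hz
    · obtain ⟨rfl, rfl⟩ : x = 0 ∧ m = 0 := by omega
      have e : wedge n h 1 0 (3 * 0 + 1) = h + n / 4 := wedge_one_axis h1 (by linarith)
      refine ⟨by omega, fun _ => ?_, by omega, by omega, fun _ _ _ => ?_, by omega, by omega⟩
      · rw [e]
        constructor <;> linarith
      · rw [e]
        linarith
    · have e : wedge n h 1 x (3 * m + 1) = h := wedge_one_of_odd h1 _ _ (by omega) (by omega)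
      exact ⟨fun _ => e, by omega, by omega, by omega, by omega, by omega, by omega⟩
  · have e : wedge n h 1 x (3 * m + 2) = h := wedge_one_of_odd h1 _ _ (by omega) (by omega)
    exact ⟨fun _ => e, by omega, by omega, by omega⟩

lemma octagonZero_origin (hh : h < 13 / 18) (hn : n = 3) (t : ℕ) (hp : t % 2 = 0)
    (P : OctagonState n h t) (Q : OctagonState n h (t + 1)) : OctagonZero n h (t + 2) 0 0 := by
  have e := wedge_two_step_origin (n := n) (h := h) (by linarith) t hp
  refine ⟨by omega, by omega, by omega, by omega, by omega, fun _ => ?_⟩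
  have hr : 1 ≤ wedge n h t 0 0 := by
    rcases Nat.eq_zero_or_pos t with rfl | ht
    · rw [wedge_zero_zero]; linarith
    · exact ((P.zero 0 0 (by omega)).later (by omega)).1
  have ha : 1 ≤ wedge n h (t + 1) 0 1 ∧ wedge n h (t + 1) 0 1 ≤ 53 / 25 :=
    (Q.one 0 0 (by omega)).fired hh (by omega)
  rw [Nat.mul_zero, e, rest_of_le hr, fire_of_le ha.1, zero_add]
  exact ha

lemma octagonZero_diagonal (h0 : 5 / 7 ≤ h) (hh : h < 13 / 18) (t x : ℕ) (hp : t % 2 = 0)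
    (P : OctagonState n h t) (Q : OctagonState n h (t + 1)) :
    OctagonZero n h (t + 2) (x + 1) 0 := by
  have h1 : h < 1 := by linarith
  have H := P.zero (x + 1) 0 (by omega)
  have Ha := Q.one (x + 1) 0 (by omega)
  have Hb := Q.one x 0 (by omega)
  have e : wedge n h (t + 2) (x + 1) (3 * 0) = rest (wedge n h t (x + 1) (3 * 0)) +
      (2 * fire (wedge n h (t + 1) (x + 1) (3 * 0 + 1)) +
        2 * fire (wedge n h (t + 1) x (3 * 0 + 1))) / 4 := wedge_two_step_diagonal h1 t x hp
  have hf : t + 2 < 2 * (x + 1) → wedge n h (t + 2) (x + 1) (3 * 0) = h := by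
    intro ht
    rw [e, H.preDiag (by omega) rfl, rest_of_lt h1, Ha.fire_eq_zero h1 (by omega),
      Hb.fire_eq_zero h1 (by omega)]
    ring
  refine ⟨fun ht => hf (by omega), by omega, fun ht _ => hf ht, by omega, ?_, ?_⟩
  · intro ht _ _
    have hb := Hb.first (by omega)
    have hb' : 129 / 100 ≤ wedge n h (t + 1) x (3 * 0 + 1) := by
      rcases Nat.eq_zero_or_pos x with hx | hx
      · exact Hb.firstOrigin (by omega) hx rfl
      · exact Hb.firstDiag (by omega) hx rfl
    rw [e, H.preDiag (by omega) rfl, rest_of_lt h1, Ha.fire_eq_zero h1 (by omega),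
      fire_of_le (by linarith)]
    constructor <;> linarith
  · intro ht
    have ha := Ha.fired hh (by omega)
    have hb := Hb.fired hh (by omega)
    rw [e, rest_of_le (H.fired h0 (by omega) (by omega)).1, fire_of_le ha.1, fire_of_le hb.1]
    constructor <;> linarith

lemma octagonZero_succ (h0 : 5 / 7 ≤ h) (hh : h < 13 / 18) (t x m : ℕ) (hp : (t + m) % 2 = 1)
    (P : OctagonState n h t) (Q : OctagonState n h (t + 1)) :
    OctagonZero n h (t + 2) x (m + 1) := by
  have h1 : h < 1 := by linarith
  have H := P.zero x (m + 1) (by omega)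
  have Ha := Q.one x (m + 1) (by omega)
  have Hb := Q.two x m (by omega)
  have Ho := Q.two (x + 1) m (by omega)
  -- The fourth neighbour is a mirror image in class `3 * m + 2` on the axis and a site of the next
  -- class `3 * (m + 1) + 1` elsewhere; the argument needs only the timing and bounds they share.
  obtain ⟨v, hv0, hv1, hv2, e⟩ : ∃ v : ℝ, (t + 1 < 2 * x + 5 * m + 4 → fire v = 0) ∧
      (t + 1 = 2 * x + 5 * m + 4 → 1 ≤ v ∧ v ≤ 153 / 100) ∧
      (2 * x + 5 * m + 4 < t + 1 → 1 ≤ v ∧ v ≤ 53 / 25) ∧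
      wedge n h (t + 2) x (3 * (m + 1)) = rest (wedge n h t x (3 * (m + 1))) +
        (fire (wedge n h (t + 1) x (3 * (m + 1) + 1)) + fire (wedge n h (t + 1) x (3 * m + 2)) +
          fire (wedge n h (t + 1) (x + 1) (3 * m + 2)) + fire v) / 4 := by
    rcases x with _ | x
    · refine ⟨wedge n h (t + 1) 1 (3 * m + 2), fun ht => Ho.fire_eq_zero h1 (by omega),
        fun ht => ?_, fun ht => Ho.fired hh (by omega), ?_⟩
      · have := Ho.first (by omega)
        exact ⟨this.1, this.2.trans (by linarith)⟩
      · have := wedge_two_step_axis (n := n) h1 t (3 * m + 2) (by omega)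
        rw [show 3 * (m + 1) = 3 * m + 2 + 1 by ring, this]
        ring
    · have Hi := Q.one x (m + 1) (by omega)
      refine ⟨wedge n h (t + 1) x (3 * (m + 1) + 1), fun ht => Hi.fire_eq_zero h1 (by omega),
        fun ht => ?_, fun ht => Hi.fired hh (by omega),
        wedge_two_step_interior h1 t x (3 * m + 2) (by omega)⟩
      have := Hi.first (by omega)
      exact ⟨by linarith, this.2⟩
  refine ⟨?_, ?_, by omega, ?_, by omega, ?_⟩
  · intro ht
    rw [e, H.far (by omega), rest_of_lt h1, Ha.fire_eq_zero h1 (by omega),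
      Hb.fire_eq_zero h1 (by omega), Ho.fire_eq_zero h1 (by omega), hv0 (by omega)]
    ring
  · intro ht _
    have hb := Hb.first (by omega)
    rw [e, H.far (by omega), rest_of_lt h1, Ha.fire_eq_zero h1 (by omega),
      fire_of_le hb.1, Ho.fire_eq_zero h1 (by omega), hv0 (by omega)]
    constructor <;> linarith
  · intro ht _
    have hr := H.pre (by omega) (by omega)
    have hb := Hb.second (by omega)
    have ho := Ho.first (by omega)
    have hi := hv1 (by omega)
    rw [e, rest_of_lt hr.2, Ha.fire_eq_zero h1 (by omega), fire_of_le hb.1, fire_of_le ho.1,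
      fire_of_le hi.1]
    constructor <;> linarith
  · intro ht
    have ha := Ha.fired hh (by omega)
    have hb := Hb.fired hh (by omega)
    have ho := Ho.fired hh (by omega)
    have hi := hv2 (by omega)
    rw [e, rest_of_le (H.fired h0 (by omega) (by omega)).1, fire_of_le ha.1, fire_of_le hb.1,
      fire_of_le ho.1, fire_of_le hi.1]
    constructor <;> linarith

lemma octagonOne_axis (h0 : 5 / 7 ≤ h) (hh : h < 13 / 18) (t m : ℕ) (hp : (t + m) % 2 = 1)
    (P : OctagonState n h t) (Q : OctagonState n h (t + 1)) :
    OctagonOne n h (t + 2) 0 m := by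
  have h1 : h < 1 := by linarith
  have H := P.one 0 m (by omega)
  have Ha := Q.two 0 m (by omega)
  have Hb := Q.zero 0 m (by omega)
  have Ho := Q.zero 1 m (by omega)
  have e := wedge_two_step_axis (n := n) h1 t (3 * m) (by omega)
  refine ⟨?_, ?_, by omega, by omega, by omega, ?_, ?_⟩
  · intro ht
    rw [e, H.far (by omega), rest_of_lt h1, Ha.fire_eq_zero h1 (by omega),
      Hb.fire_eq_zero h1 (by omega) (by omega), Ho.fire_eq_zero h1 (by omega) (by omega)]
    ring
  · intro ht
    -- On the axis the new wave must be strong enough for the next site: `h + (h + 1) / 4 ≥ 4 - 4 *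
    -- h` is equivalent to `5 / 7 ≤ h`.
    have hb := Hb.first (by omega) (by omega)
    rw [e, H.far (by omega), rest_of_lt h1, Ha.fire_eq_zero h1 (by omega),
      Ho.fire_eq_zero h1 (by omega) (by omega), fire_of_le (by linarith)]
    constructor <;> linarith
  · intro ht _ hm
    have ha := Ha.first (by omega)
    have hb := Hb.later (by omega)
    have ho := Ho.first (by omega) hm
    rw [e, rest_of_le (H.fired hh (by omega)).1, fire_of_le ha.1, fire_of_le hb.1,
      fire_of_le (by linarith)]
    linarith
  · intro ht
    have ha := Ha.fired hh (by omega)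
    have hb := Hb.fired h0 (by omega) (by omega)
    have ho := Ho.fired h0 (by omega) (by omega)
    rw [e, rest_of_le (H.fired hh (by omega)).1, fire_of_le ha.1, fire_of_le hb.1,
      fire_of_le ho.1]
    constructor <;> linarith

lemma octagonOne_interior (h0 : 5 / 7 ≤ h) (hh : h < 13 / 18) (t x m : ℕ) (hp : (t + m) % 2 = 1)
    (P : OctagonState n h t) (Q : OctagonState n h (t + 1)) :
    OctagonOne n h (t + 2) (x + 1) m := by
  have h1 : h < 1 := by linarith
  have H := P.one (x + 1) m (by omega)
  have Ha := Q.two (x + 1) m (by omega)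
  have Hb := Q.zero (x + 1) m (by omega)
  have Ho := Q.zero (x + 2) m (by omega)
  have Hi := Q.two x m (by omega)
  have e := wedge_two_step_interior (n := n) h1 t x (3 * m) (by omega)
  have hd : t + 2 = 2 * (x + 1) + 5 * m + 1 → wedge n h (t + 2) (x + 1) (3 * m + 1) =
      h + (wedge n h (t + 1) (x + 1) (3 * m) + wedge n h (t + 1) x (3 * m + 2)) / 4 := by
    intro ht
    rw [e, H.far (by omega), rest_of_lt h1, Ha.fire_eq_zero h1 (by omega),
      fire_of_le (Hb.fired h0 (by omega) (by omega)).1,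
      Ho.fire_eq_zero h1 (by omega) (by omega), fire_of_le (Hi.first (by omega)).1]
    ring
  have hdiag : t + 2 = 2 * (x + 1) + 5 * m + 1 → m = 0 →
      129 / 100 ≤ wedge n h (t + 2) (x + 1) (3 * m + 1) := by
    intro ht hm
    have hb := Hb.firstDiag (by omega) hm (by omega)
    have hi := Hi.first (by omega)
    rw [hd ht]
    linarith
  have hint : t + 2 = 2 * (x + 1) + 5 * m + 1 → 0 < m →
      (5 * h + 2) / 4 ≤ wedge n h (t + 2) (x + 1) (3 * m + 1) := by
    intro ht hm
    have hb := Hb.first (by omega) hm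
    have hi := Hi.first (by omega)
    rw [hd ht]
    linarith
  refine ⟨?_, ?_, fun ht _ hm => hint ht hm, fun ht _ hm => hdiag ht hm, by omega, by omega, ?_⟩
  · intro ht
    rw [e, H.far (by omega), rest_of_lt h1, Ha.fire_eq_zero h1 (by omega),
      Hb.fire_eq_zero h1 (by omega) (by omega), Ho.fire_eq_zero h1 (by omega) (by omega),
      Hi.fire_eq_zero h1 (by omega)]
    ring
  · intro ht
    constructor
    · rcases Nat.eq_zero_or_pos m with hm | hm
      · linarith [hdiag ht hm]
      · linarith [hint ht hm]
    · have hb := Hb.fired h0 (by omega) (by omega)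
      have hi := Hi.first (by omega)
      rw [hd ht]
      linarith
  · intro ht
    have ha := Ha.fired hh (by omega)
    have hb := Hb.fired h0 (by omega) (by omega)
    have ho := Ho.fired h0 (by omega) (by omega)
    have hi := Hi.fired hh (by omega)
    rw [e, rest_of_le (H.fired hh (by omega)).1, fire_of_le ha.1, fire_of_le hb.1,
      fire_of_le ho.1, fire_of_le hi.1]
    constructor <;> linarith

/-- This makes `(0, 2)` split again at time `4`. The interval bounds are too weak so near the
origin, where the sideways neighbour of `(0, 1)` is diagonal, so the first steps are computed
explicitly. -/
lemma octagon_early (h0 : 5 / 7 ≤ h) (hh : h < 13 / 18) (hn : n = 3) :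
    4 ≤ wedge n h 3 0 1 + 2 * wedge n h 3 1 1 := by
  have h1 : h < 1 := by linarith
  have a1 : wedge n h 1 0 1 = h + 3 / 4 := by rw [wedge_one_axis h1 (by linarith), hn]
  have a2 : wedge n h 1 1 1 = h := wedge_one_of_odd h1 _ _ (by omega) (by omega)
  have a3 : wedge n h 1 0 3 = h := wedge_one_of_odd h1 _ _ (by omega) (by omega)
  have a5 : wedge n h 1 1 3 = h := wedge_one_of_odd h1 _ _ (by omega) (by omega)
  have a6 : wedge n h 1 2 1 = h := wedge_one_of_odd h1 _ _ (by omega) (by omega)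
  have z0 : wedge n h 0 0 0 = 3 := by rw [wedge_zero_zero, hn]
  have z1 : wedge n h 0 0 2 = h := wedge_zero_of_ne _ _ (by omega)
  have z2 : wedge n h 0 1 0 = h := wedge_zero_of_ne _ _ (by omega)
  have z3 : wedge n h 0 1 2 = h := wedge_zero_of_ne _ _ (by omega)
  have z4 : wedge n h 0 2 0 = h := wedge_zero_of_ne _ _ (by omega)
  have f : fire (h + 3 / 4) = h + 3 / 4 := fire_of_le (by linarith)
  have fh : fire h = 0 := fire_of_lt h1
  have b0 : wedge n h 2 0 0 = h + 3 / 4 := by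
    rw [wedge_two_step_origin h1 0 rfl, z0, a1, f, rest_of_le (by norm_num)]
    ring
  have b1 : wedge n h 2 0 2 = h + (h + 3 / 4) / 4 := by
    rw [wedge_two_step_axis h1 0 1 rfl, z1, a3, a1, a2, f, fh, rest_of_lt h1]
    ring
  have b2 : wedge n h 2 1 0 = h + (h + 3 / 4) / 2 := by
    rw [wedge_two_step_diagonal h1 0 0 rfl, z2, a1, a2, f, fh, rest_of_lt h1]
    ring
  have b3 : fire (wedge n h 2 1 2) = 0 := by
    rw [wedge_two_step_interior h1 0 0 1 rfl, z3, a5, a2, a6, a3, fh, rest_of_lt h1]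
    exact fire_of_lt (by linarith)
  have b4 : fire (wedge n h 2 2 0) = 0 := by
    rw [wedge_two_step_diagonal h1 0 1 rfl, z4, a6, a2, fh, rest_of_lt h1]
    exact fire_of_lt (by linarith)
  have f1 : fire (h + (h + 3 / 4) / 4) = h + (h + 3 / 4) / 4 := fire_of_le (by linarith)
  have f2 : fire (h + (h + 3 / 4) / 2) = h + (h + 3 / 4) / 2 := fire_of_le (by linarith)
  rw [wedge_two_step_axis h1 1 0 rfl, wedge_two_step_interior h1 1 0 0 rfl, a1, a2, b0, b1, b2, b3,
    b4, f, f1, f2, rest_of_le (by linarith), rest_of_lt h1]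
  linarith

lemma octagonTwo_axis (h0 : 5 / 7 ≤ h) (hh : h < 13 / 18) (hn : n = 3) (t m : ℕ)
    (hp : (t + m) % 2 = 0) (P : OctagonState n h t) (Q : OctagonState n h (t + 1)) :
    OctagonTwo n h (t + 2) 0 m := by
  have h1 : h < 1 := by linarith
  have H := P.two 0 m (by omega)
  have Ha := Q.zero 0 (m + 1) (by omega)
  have Hb := Q.one 0 m (by omega)
  have Ho := Q.one 1 m (by omega)
  have e : wedge n h (t + 2) 0 (3 * m + 2) = rest (wedge n h t 0 (3 * m + 2)) +
      (fire (wedge n h (t + 1) 0 (3 * (m + 1))) + fire (wedge n h (t + 1) 0 (3 * m + 1)) +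
        2 * fire (wedge n h (t + 1) 1 (3 * m + 1))) / 4 :=
    wedge_two_step_axis h1 t (3 * m + 1) (by omega)
  have hs : t + 2 = 2 * 0 + 5 * m + 4 →
      1 ≤ wedge n h (t + 2) 0 (3 * m + 2) ∧ wedge n h (t + 2) 0 (3 * m + 2) ≤ 159 / 100 := by
    intro ht
    have hb := Hb.later (by omega)
    have ho := Ho.first (by omega)
    rw [e, rest_of_le (H.fired hh (by omega)).1, Ha.fire_eq_zero h1 (by omega) (by omega),
      fire_of_le hb.1, fire_of_le (by linarith)]
    constructor
    · rcases Nat.eq_zero_or_pos m with rfl | hm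
      · obtain rfl : t = 2 := by omega
        have : 4 ≤ wedge n h (2 + 1) 0 (3 * 0 + 1) + 2 * wedge n h (2 + 1) 1 (3 * 0 + 1) :=
          octagon_early h0 hh hn
        linarith
      · have hb' := Hb.secondAxis (by omega) rfl hm
        have ho' := Ho.firstInterior (by omega) (by omega) hm
        linarith
    · linarith
  refine ⟨?_, ?_, hs, ?_⟩
  · intro ht
    rw [e, H.far (by omega), rest_of_lt h1, Ha.fire_eq_zero h1 (by omega) (by omega),
      Hb.fire_eq_zero h1 (by omega), Ho.fire_eq_zero h1 (by omega)]
    ring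
  · intro ht
    have hb := Hb.first (by omega)
    rw [e, H.far (by omega), rest_of_lt h1, Ha.fire_eq_zero h1 (by omega) (by omega),
      Ho.fire_eq_zero h1 (by omega), fire_of_le (by linarith)]
    constructor <;> linarith
  · intro ht
    rcases Nat.lt_or_ge (5 * m + 4) (t + 2) with hlt | hge
    · have ha := Ha.fired h0 (by omega) (by omega)
      have hb := Hb.fired hh (by omega)
      have ho := Ho.fired hh (by omega)
      rw [e, rest_of_le (H.fired hh (by omega)).1, fire_of_le ha.1, fire_of_le hb.1,
        fire_of_le ho.1]
      constructor <;> linarith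
    · have := hs (by omega)
      exact ⟨this.1, this.2.trans (by norm_num)⟩

lemma octagonTwo_interior (h0 : 5 / 7 ≤ h) (hh : h < 13 / 18) (t x m : ℕ)
    (hp : (t + m) % 2 = 0) (P : OctagonState n h t) (Q : OctagonState n h (t + 1)) :
    OctagonTwo n h (t + 2) (x + 1) m := by
  have h1 : h < 1 := by linarith
  have H := P.two (x + 1) m (by omega)
  have Ha := Q.zero (x + 1) (m + 1) (by omega)
  have Hb := Q.one (x + 1) m (by omega)
  have Ho := Q.one (x + 2) m (by omega)
  have Hi := Q.zero x (m + 1) (by omega)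
  have e : wedge n h (t + 2) (x + 1) (3 * m + 2) = rest (wedge n h t (x + 1) (3 * m + 2)) +
      (fire (wedge n h (t + 1) (x + 1) (3 * (m + 1))) +
        fire (wedge n h (t + 1) (x + 1) (3 * m + 1)) +
        fire (wedge n h (t + 1) (x + 2) (3 * m + 1)) +
        fire (wedge n h (t + 1) x (3 * (m + 1)))) / 4 :=
    wedge_two_step_interior h1 t x (3 * m + 1) (by omega)
  have hs : t + 2 = 2 * (x + 1) + 5 * m + 4 →
      1 ≤ wedge n h (t + 2) (x + 1) (3 * m + 2) ∧
        wedge n h (t + 2) (x + 1) (3 * m + 2) ≤ 159 / 100 := by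
    intro ht
    have hb := Hb.later (by omega)
    -- The outer neighbour is still silent, so three masses of at most `53 / 25` give `159 / 100`.
    have ho := Ho.fired hh (by omega)
    have hi := Hi.first (by omega) (by omega)
    have ho' : 129 / 100 ≤ wedge n h (t + 1) (x + 2) (3 * m + 1) := by
      rcases Nat.eq_zero_or_pos m with hm | hm
      · exact Ho.firstDiag (by omega) (by omega) hm
      · linarith [Ho.firstInterior (by omega) (by omega) hm]
    rw [e, rest_of_le (H.fired hh (by omega)).1, Ha.fire_eq_zero h1 (by omega) (by omega),
      fire_of_le hb.1, fire_of_le ho.1, fire_of_le (v := wedge n h (t + 1) x (3 * (m + 1)))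
        (by linarith)]
    constructor <;> linarith
  refine ⟨?_, ?_, hs, ?_⟩
  · intro ht
    rw [e, H.far (by omega), rest_of_lt h1, Ha.fire_eq_zero h1 (by omega) (by omega),
      Hb.fire_eq_zero h1 (by omega), Ho.fire_eq_zero h1 (by omega),
      Hi.fire_eq_zero h1 (by omega) (by omega)]
    ring
  · intro ht
    have hb := Hb.first (by omega)
    rw [e, H.far (by omega), rest_of_lt h1, Ha.fire_eq_zero h1 (by omega) (by omega),
      Ho.fire_eq_zero h1 (by omega), Hi.fire_eq_zero h1 (by omega) (by omega),
      fire_of_le (by linarith)]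
    constructor <;> linarith
  · intro ht
    rcases Nat.lt_or_ge (2 * (x + 1) + 5 * m + 4) (t + 2) with hlt | hge
    · have ha := Ha.fired h0 (by omega) (by omega)
      have hb := Hb.fired hh (by omega)
      have ho := Ho.fired hh (by omega)
      have hi := Hi.fired h0 (by omega) (by omega)
      rw [e, rest_of_le (H.fired hh (by omega)).1, fire_of_le ha.1, fire_of_le hb.1,
        fire_of_le ho.1, fire_of_le hi.1]
      constructor <;> linarith
    · have := hs (by omega)
      exact ⟨this.1, this.2.trans (by norm_num)⟩

lemma octagonState_succ (h0 : 5 / 7 ≤ h) (hh : h < 13 / 18) (hn : n = 3) (t : ℕ)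
    (P : OctagonState n h t) (Q : OctagonState n h (t + 1)) : OctagonState n h (t + 2) := by
  refine ⟨fun x m hp => ?_, fun x m hp => ?_, fun x m hp => ?_⟩
  · rcases m with _ | m
    · rcases x with _ | x
      · exact octagonZero_origin hh hn t (by omega) P Q
      · exact octagonZero_diagonal h0 hh t x (by omega) P Q
    · exact octagonZero_succ h0 hh t x m (by omega) P Q
  · rcases x with _ | x
    · exact octagonOne_axis h0 hh t m (by omega) P Q
    · exact octagonOne_interior h0 hh t x m (by omega) P Q
  · rcases x with _ | x
    · exact octagonTwo_axis h0 hh hn t m (by omega) P Q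
    · exact octagonTwo_interior h0 hh t x m (by omega) P Q

lemma octagon_states (h0 : 5 / 7 ≤ h) (hh : h < 13 / 18) (hn : n = 3) (t : ℕ) :
    OctagonState n h t ∧ OctagonState n h (t + 1) := by
  induction t with
  | zero => exact ⟨octagonState_zero, octagonState_one h0 hh hn⟩
  | succ t ih => exact ⟨ih.2, octagonState_succ h0 hh hn t ih.1 ih.2⟩

lemma isFirstSplit_octagon (h0 : 5 / 7 ≤ h) (hh : h < 13 / 18) (hn : n = 3) :
    IsFirstSplit n h (fun x j => 2 * x + 5 * (j / 3) + j % 3) := by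
  have h1 : h < 1 := by linarith
  have S := fun t => (octagon_states h0 hh hn t).1
  intro x j
  obtain ⟨m, r, hr, rfl⟩ : ∃ m r, r < 3 ∧ j = 3 * m + r :=
    ⟨j / 3, j % 3, Nat.mod_lt _ (by norm_num), by omega⟩
  have e : 2 * x + 5 * ((3 * m + r) / 3) + (3 * m + r) % 3 = 2 * x + 5 * m + r := by omega
  simp only [e]
  interval_cases r
  · constructor
    · rcases Nat.eq_zero_or_pos (x + m) with hz | hz
      · obtain ⟨rfl, rfl⟩ : x = 0 ∧ m = 0 := by omega
        simp only [Nat.mul_zero, Nat.add_zero, wedge_zero_zero]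
        linarith
      · exact (((S (2 * x + 5 * m)).zero x m (by omega)).fired h0 (by omega) le_rfl).1
    · intro t ht
      rcases Nat.mod_two_eq_zero_or_one (t + m) with hp | hp
      · by_contra hc
        have := ((S t).zero x m hp).fire_eq_zero h1 ht hp
        have hle : 1 ≤ wedge n h t x (3 * m) := not_lt.mp hc
        rw [fire_of_le hle] at this
        linarith
      · exact wedge_lt_one_of_odd h1 _ _ _ (by omega)
  · refine ⟨(((S (2 * x + 5 * m + 1)).one x m (by omega)).fired hh le_rfl).1, fun t ht => ?_⟩
    rcases Nat.mod_two_eq_zero_or_one (t + m) with hp | hp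
    · exact wedge_lt_one_of_odd h1 _ _ _ (by omega)
    · rw [((S t).one x m hp).far ht]
      exact h1
  · refine ⟨(((S (2 * x + 5 * m + 2)).two x m (by omega)).fired hh le_rfl).1, fun t ht => ?_⟩
    rcases Nat.mod_two_eq_zero_or_one (t + m) with hp | hp
    · rw [((S t).two x m hp).far ht]
      exact h1
    · exact wedge_lt_one_of_odd h1 _ _ _ (by omega)

end Octagon

/-! ### The diamond -/

/-- The graph distance of a site to the origin. -/
def graphNorm {d : ℕ} (x : Site d) : ℕ := ∑ i, (x i).natAbs

lemma graphNorm_add_natAbs {d : ℕ} {x y : Site d} (i : Fin d) (hxy : ∀ j ≠ i, y j = x j) :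
    graphNorm y + (x i).natAbs = graphNorm x + (y i).natAbs := by
  unfold graphNorm
  rw [← Finset.add_sum_erase _ _ (Finset.mem_univ i),
    ← Finset.add_sum_erase (f := fun i => (x i).natAbs) _ (Finset.mem_univ i),
    Finset.sum_congr rfl fun j hj => by rw [hxy j (Finset.ne_of_mem_erase hj)]]
  ring

lemma graphNorm_add_single {d : ℕ} (x : Site d) (i : Fin d) (a : ℤ) :
    graphNorm (x + Pi.single i a) + (x i).natAbs = graphNorm x + (x i + a).natAbs := by
  have := graphNorm_add_natAbs (x := x) (y := x + Pi.single i a) i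
    (fun j hj => by simp [Pi.single_eq_of_ne hj])
  simpa using this

lemma graphNorm_sub_single {d : ℕ} (x : Site d) (i : Fin d) (a : ℤ) :
    graphNorm (x - Pi.single i a) + (x i).natAbs = graphNorm x + (x i - a).natAbs := by
  have := graphNorm_add_natAbs (x := x) (y := x - Pi.single i a) i
    (fun j hj => by simp [Pi.single_eq_of_ne hj])
  simpa using this

/-- Influence travels at most one lattice step per time step. -/
lemma config_eq_of_lt_graphNorm {d : ℕ} {n h : ℝ} (hh : h < 1) (s : ℕ) (x : Site d)
    (hx : s < graphNorm x) : config d n h s x = h := by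
  induction s generalizing x with
  | zero =>
    have : x ≠ 0 := by
      rintro rfl
      simp [graphNorm] at hx
    simp [config, initial, this]
  | succ s ih =>
    rw [config_succ, ih x (by omega), rest_of_lt hh, Finset.sum_eq_zero, mul_zero, add_zero]
    intro i _
    have h1 := graphNorm_add_single x i 1
    have h2 := graphNorm_sub_single x i 1
    rw [ih (x + Pi.single i 1) (by omega), ih (x - Pi.single i 1) (by omega), fire_of_lt hh,
      add_zero]

lemma one_le_config_graphNorm {d : ℕ} {n h : ℝ} (hd : 1 ≤ d) (h0 : 1 - 1 / (2 * (d : ℝ)) ≤ h)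
    (hh : h < 1) (hn : 1 ≤ n) (s : ℕ) (x : Site d) (hx : graphNorm x = s) :
    1 ≤ config d n h s x := by
  induction s generalizing x with
  | zero =>
    have : x = 0 := by
      ext i
      have := (Finset.sum_eq_zero_iff.mp hx) i (Finset.mem_univ i)
      simpa using this
    simp [config, initial, this, hn]
  | succ s ih =>
    obtain ⟨i, hi⟩ : ∃ i, x i ≠ 0 := by
      by_contra hc
      push Not at hc
      simp [graphNorm, hc] at hx
    have hd' : (0 : ℝ) < d := by exact_mod_cast hd
    -- A step towards the origin along a nonzero coordinate reaches a site that is unstable at time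
    -- `s`; its share of at least `1 / (2 * d)` lifts the untouched mass `h` to `1`.
    have hone : 1 ≤ fire (config d n h s (x + Pi.single i 1)) +
        fire (config d n h s (x - Pi.single i 1)) := by
      have f1 := fire_nonneg (config d n h s (x + Pi.single i 1))
      have f2 := fire_nonneg (config d n h s (x - Pi.single i 1))
      have h1 := graphNorm_add_single x i 1
      have h2 := graphNorm_sub_single x i 1
      rcases lt_or_gt_of_ne hi with hneg | hpos
      · have := ih (x + Pi.single i 1) (by omega)
        rw [fire_of_le this]
        linarith
      · have := ih (x - Pi.single i 1) (by omega)
        rw [fire_of_le this]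
        linarith
    have hsum : 1 ≤ ∑ i : Fin d, (fire (config d n h s (x + Pi.single i 1)) +
        fire (config d n h s (x - Pi.single i 1))) :=
      hone.trans (Finset.single_le_sum (f := fun i => fire (config d n h s (x + Pi.single i 1)) +
        fire (config d n h s (x - Pi.single i 1)))
        (fun j _ => add_nonneg (fire_nonneg _) (fire_nonneg _)) (Finset.mem_univ i))
    rw [config_succ, config_eq_of_lt_graphNorm hh s x (by omega), rest_of_lt hh]
    have : 1 / (2 * (d : ℝ)) * 1 ≤ 1 / (2 * (d : ℝ)) *
        ∑ i : Fin d, (fire (config d n h s (x + Pi.single i 1)) +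
          fire (config d n h s (x - Pi.single i 1))) :=
      mul_le_mul_of_nonneg_left hsum (by positivity)
    linarith

lemma mem_splitCluster_iff_graphNorm {d : ℕ} {n h : ℝ} (hd : 1 ≤ d)
    (h0 : 1 - 1 / (2 * (d : ℝ)) ≤ h) (hh : h < 1) (hn : 1 ≤ n) (t : ℕ) (x : Site d) :
    x ∈ splitCluster d n h t ↔ graphNorm x < t := by
  constructor
  · rintro ⟨s, hs, hx⟩
    by_contra hc
    have hx' : 1 ≤ config d n h s x := hx
    rw [config_eq_of_lt_graphNorm hh s x (by omega)] at hx'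
    linarith
  · intro hx
    exact ⟨graphNorm x, hx, one_le_config_graphNorm hd h0 hh hn _ x rfl⟩

lemma norm_le_sum_abs {d : ℕ} (v : EuclideanSpace ℝ (Fin d)) : ‖v‖ ≤ ∑ i, |v i| := by
  rw [EuclideanSpace.norm_eq]
  refine Real.sqrt_le_iff.mpr ⟨Finset.sum_nonneg fun i _ => abs_nonneg _, ?_⟩
  exact Finset.sum_sq_le_sq_sum_of_nonneg fun i _ => abs_nonneg (v i)

lemma abs_apply_le_norm {d : ℕ} (v : EuclideanSpace ℝ (Fin d)) (i : Fin d) : |v i| ≤ ‖v‖ :=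
  PiLp.norm_apply_le v i

theorem isLimitingShape_diamond {d : ℕ} {n h : ℝ} (hd : 1 ≤ d)
    (h0 : 1 - 1 / (2 * (d : ℝ)) ≤ h) (hh : h < 1) (hn : 1 ≤ n) :
    IsLimitingShape (diamond d) (splitCluster d n h) (fun t : ℕ => 1 / (t : ℝ)) := by
  refine isLimitingShape_of_gauge (N := fun v => ∑ i, |v i|) (τ := graphNorm) (K := 0) (c := 1)
    (C := d) one_pos one_pos (Nat.cast_nonneg d) ?_ ?_ ?_ ?_ ?_
    (mem_splitCluster_iff_graphNorm hd h0 hh hn) ?_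
  · intro r hr v
    simp [abs_mul, abs_of_nonneg hr, Finset.mul_sum]
  · intro u v
    rw [← Finset.sum_add_distrib]
    exact Finset.sum_le_sum fun i _ => abs_add_le _ _
  · intro v
    rw [one_mul]
    exact norm_le_sum_abs v
  · intro v
    calc ∑ i, |v i| ≤ ∑ _i : Fin d, ‖v‖ := Finset.sum_le_sum fun i _ => abs_apply_le_norm v i
      _ = d * ‖v‖ := by simp
  · constructor
    · refine ⟨EuclideanSpace.single ⟨0, hd⟩ 1, ?_, ⟨0, hd⟩, by simp⟩
      change ∑ i, |(EuclideanSpace.single (⟨0, hd⟩ : Fin d) (1 : ℝ)) i| ≤ 1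
      rw [Finset.sum_eq_single ⟨0, hd⟩ (fun j _ hj => by simp [hj]) (by simp)]
      simp
    · rintro r ⟨x, hx, i, rfl⟩
      exact (le_abs_self _).trans
        ((Finset.single_le_sum (f := fun i => |x i|) (fun j _ => abs_nonneg _)
          (Finset.mem_univ i)).trans hx)
  · intro y
    simp [graphNorm, toPoint]

/-! ### Octagonal gauges and the planar shapes -/

lemma mem_splitCluster_iff {n h : ℝ} {τ : ℕ → ℕ → ℕ} (H : IsFirstSplit n h τ) (t : ℕ)
    (x : Site 2) :
    x ∈ splitCluster 2 n h t ↔ τ (min (x 0).natAbs (x 1).natAbs)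
      (max (x 0).natAbs (x 1).natAbs - min (x 0).natAbs (x 1).natAbs) < t := by
  have e : ∀ s, config 2 n h s x = wedge n h s (min (x 0).natAbs (x 1).natAbs)
      (max (x 0).natAbs (x 1).natAbs - min (x 0).natAbs (x 1).natAbs) := by
    intro s
    rw [← planar_eq_wedge, planar]
    congr 1
    ext i
    fin_cases i <;> rfl
  obtain ⟨h1, h2⟩ := H (min (x 0).natAbs (x 1).natAbs)
    (max (x 0).natAbs (x 1).natAbs - min (x 0).natAbs (x 1).natAbs)
  constructor
  · rintro ⟨s, hs, hx⟩
    have hx' : 1 ≤ config 2 n h s x := hx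
    rw [e] at hx'
    by_contra hc
    linarith [h2 s (by omega)]
  · intro hx
    refine ⟨_, hx, ?_⟩
    change 1 ≤ config 2 n h _ x
    rw [e]
    exact h1

/-- The gauge of the octagon (the square for `b = 0`) with vertices `(0, ±1)`, `(±1, 0)` and
`(±1 / (1 + b), ±1 / (1 + b))`. -/
def octagonalGauge (b : ℝ) (v : EuclideanSpace ℝ (Fin 2)) : ℝ :=
  max (|v 0| + b * |v 1|) (b * |v 0| + |v 1|)

lemma abs_le_octagonalGauge {b : ℝ} (hb : 0 ≤ b) (v : EuclideanSpace ℝ (Fin 2)) (i : Fin 2) :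
    |v i| ≤ octagonalGauge b v := by
  have h0 : 0 ≤ b * |v 0| := by positivity
  have h1 : 0 ≤ b * |v 1| := by positivity
  fin_cases i
  · exact le_max_of_le_left (by simpa using h1)
  · exact le_max_of_le_right (by simpa using h0)

lemma octagonalGauge_toPoint {b : ℝ} (hb : b ≤ 1) (y : Site 2) :
    octagonalGauge b (toPoint y) = (max (y 0).natAbs (y 1).natAbs : ℕ) +
      b * (min (y 0).natAbs (y 1).natAbs : ℕ) := by
  have e : ∀ i, |toPoint y i| = ((y i).natAbs : ℝ) := by
    intro i
    simp [toPoint]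
  rw [octagonalGauge, e, e]
  rcases le_total (y 0).natAbs (y 1).natAbs with hy | hy
  · have hy' : ((y 0).natAbs : ℝ) ≤ (y 1).natAbs := by exact_mod_cast hy
    rw [max_eq_right hy, min_eq_left hy, max_eq_right (by nlinarith)]
    ring
  · have hy' : ((y 1).natAbs : ℝ) ≤ (y 0).natAbs := by exact_mod_cast hy
    rw [max_eq_left hy, min_eq_right hy, max_eq_left (by nlinarith)]

/-- In wedge coordinates the largest and smallest absolute coordinates are `x + j` and `x`, so `hτ`
compares the splitting time with the gauge; a bounded discrepancy disappears in the scaling. -/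
theorem isLimitingShape_octagonal {n h : ℝ} {τ : ℕ → ℕ → ℕ} {a b : ℝ} (ha : 0 < a) (hb : 0 ≤ b)
    (hb1 : b ≤ 1) (H : IsFirstSplit n h τ)
    (hτ : ∀ x j : ℕ, |a * ((x + j : ℕ) + b * x) - τ x j| ≤ 2) :
    IsLimitingShape {v | octagonalGauge b v ≤ 1} (splitCluster 2 n h)
      (fun t : ℕ => a / (t : ℝ)) := by
  refine isLimitingShape_of_gauge (c := 1 / 2) (C := 2) ha (by norm_num) (by norm_num) ?_ ?_ ?_ ?_
    ?_ (mem_splitCluster_iff H) (K := 2) ?_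
  · intro r hr v
    rw [octagonalGauge, octagonalGauge, mul_max_of_nonneg _ _ hr]
    simp only [PiLp.smul_apply, smul_eq_mul, abs_mul, abs_of_nonneg hr]
    congr 1 <;> ring
  · intro u v
    have h0 := abs_add_le (u 0) (v 0)
    have h1 := abs_add_le (u 1) (v 1)
    have h2 := mul_le_mul_of_nonneg_left h0 hb
    have h3 := mul_le_mul_of_nonneg_left h1 hb
    refine max_le ?_ ?_
    · refine le_trans ?_ (add_le_add (le_max_left _ _) (le_max_left _ _))
      simp only [PiLp.add_apply]
      linarith
    · refine le_trans ?_ (add_le_add (le_max_right _ _) (le_max_right _ _))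
      simp only [PiLp.add_apply]
      linarith
  · intro v
    have h0 := norm_le_sum_abs v
    rw [Fin.sum_univ_two] at h0
    linarith [abs_le_octagonalGauge hb v 0, abs_le_octagonalGauge hb v 1]
  · intro v
    have h0 := abs_apply_le_norm v 0
    have h1 := abs_apply_le_norm v 1
    have h2 : b * |v 0| ≤ 1 * ‖v‖ := mul_le_mul hb1 h0 (abs_nonneg _) zero_le_one
    have h3 : b * |v 1| ≤ 1 * ‖v‖ := mul_le_mul hb1 h1 (abs_nonneg _) zero_le_one
    exact max_le (by linarith) (by linarith)
  · constructor
    · refine ⟨EuclideanSpace.single 0 1, ?_, 0, by simp⟩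
      change octagonalGauge b _ ≤ 1
      simp [octagonalGauge, hb1]
    · rintro r ⟨x, hx, i, rfl⟩
      exact (le_abs_self _).trans ((abs_le_octagonalGauge hb x i).trans hx)
  · intro y
    have := hτ (min (y 0).natAbs (y 1).natAbs)
      (max (y 0).natAbs (y 1).natAbs - min (y 0).natAbs (y 1).natAbs)
    rw [Nat.add_sub_cancel' min_le_max] at this
    rwa [octagonalGauge_toPoint hb1]

lemma square_eq : square = {v | octagonalGauge 0 v ≤ 1} := by
  ext v
  simp [square, octagonalGauge, Fin.forall_fin_two]

lemma mem_of_convex_of_triangle {s : Set (EuclideanSpace ℝ (Fin 2))} (hs : Convex ℝ s)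
    (h0 : (0 : EuclideanSpace ℝ (Fin 2)) ∈ s) {u w v : EuclideanSpace ℝ (Fin 2)} (hu : u ∈ s)
    (hw : w ∈ s) {α β : ℝ} (hα : 0 ≤ α) (hβ : 0 ≤ β) (hαβ : α + β ≤ 1)
    (hv : v = α • u + β • w) : v ∈ s := by
  have := hs.sum_mem (t := Finset.univ) (w := ![α, β, 1 - α - β]) (z := ![u, w, 0])
    (by intro i _; fin_cases i <;> simp <;> linarith) (by simp [Fin.sum_univ_three])
    (by intro i _; fin_cases i <;> simp [*])
  rw [Fin.sum_univ_three] at this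
  simpa [hv] using this

lemma octagon_eq : octagon = {v | octagonalGauge (1 / 5) v ≤ 1} := by
  apply Set.Subset.antisymm
  · refine convexHull_min ?_ ?_
    · intro v hv
      simp only [Set.mem_insert_iff, Set.mem_singleton_iff] at hv
      rcases hv with rfl | rfl | rfl | rfl | rfl | rfl | rfl | rfl <;>
        norm_num [octagonalGauge, abs_of_pos, abs_of_neg]
    · have conv : ∀ i : Fin 2, ConvexOn ℝ Set.univ
          fun v : EuclideanSpace ℝ (Fin 2) => |v i| := by
        intro i
        refine ⟨convex_univ, fun x _ y _ α β hα hβ _ => ?_⟩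
        simpa [abs_mul, abs_of_nonneg hα, abs_of_nonneg hβ] using abs_add_le (α * x i) (β * y i)
      have h5 : (0 : ℝ) ≤ 1 / 5 := by norm_num
      have := (((conv 0).add ((conv 1).smul h5)).sup (((conv 0).smul h5).add (conv 1))).convex_le 1
      simpa [octagonalGauge] using this
  · intro v hv
    have hv' : max (|v 0| + 1 / 5 * |v 1|) (1 / 5 * |v 0| + |v 1|) ≤ 1 := hv
    rw [max_le_iff] at hv'
    obtain ⟨hv1, hv2⟩ := hv'
    have hc : Convex ℝ octagon := convex_convexHull ℝ _
    have hm := subset_convexHull ℝ ({!₂[0, 1], !₂[5 / 6, 5 / 6], !₂[1, 0], !₂[5 / 6, -(5 / 6)],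
      !₂[0, -1], !₂[-(5 / 6), -(5 / 6)], !₂[-1, 0], !₂[-(5 / 6), 5 / 6]} :
      Set (EuclideanSpace ℝ (Fin 2)))
    change _ ⊆ octagon at hm
    have m1 : (!₂[0, 1] : EuclideanSpace ℝ (Fin 2)) ∈ octagon := hm (by simp)
    have m2 : (!₂[5 / 6, 5 / 6] : EuclideanSpace ℝ (Fin 2)) ∈ octagon := hm (by simp)
    have m3 : (!₂[1, 0] : EuclideanSpace ℝ (Fin 2)) ∈ octagon := hm (by simp)
    have m4 : (!₂[5 / 6, -(5 / 6)] : EuclideanSpace ℝ (Fin 2)) ∈ octagon := hm (by simp)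
    have m5 : (!₂[0, -1] : EuclideanSpace ℝ (Fin 2)) ∈ octagon := hm (by simp)
    have m6 : (!₂[-(5 / 6), -(5 / 6)] : EuclideanSpace ℝ (Fin 2)) ∈ octagon := hm (by simp)
    have m7 : (!₂[-1, 0] : EuclideanSpace ℝ (Fin 2)) ∈ octagon := hm (by simp)
    have m8 : (!₂[-(5 / 6), 5 / 6] : EuclideanSpace ℝ (Fin 2)) ∈ octagon := hm (by simp)
    have m0 : (0 : EuclideanSpace ℝ (Fin 2)) ∈ octagon := by
      have := hc m3 m7 (a := 1 / 2) (b := 1 / 2) (by norm_num) (by norm_num) (by norm_num)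
      convert this using 1
      ext i
      fin_cases i <;> simp
    -- Each point lies in the triangle spanned by the origin, an axis vertex and a diagonal vertex.
    -- The factor `6 / 5` normalises `(5 / 6, 5 / 6)`, and the coefficients sum to `max + min / 5`,
    -- the gauge itself.
    have key := fun {u w} hu hw => mem_of_convex_of_triangle hc m0 (u := u) (w := w) (v := v)
      (α := |(|v 1| - |v 0|)|) (β := 6 / 5 * min |v 0| |v 1|) hu hw (abs_nonneg _) (by positivity)
      (by
        rcases le_total |v 0| |v 1| with hle | hle
        · rw [abs_of_nonneg (by linarith), min_eq_left hle]; linarith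
        · rw [abs_of_nonpos (by linarith), min_eq_right hle]; linarith)
    rcases le_total |v 0| |v 1| with hle | hle
    · rw [abs_of_nonneg (by linarith), min_eq_left hle] at key
      rcases abs_cases (v 0) with ⟨e0, -⟩ | ⟨e0, -⟩ <;>
        rcases abs_cases (v 1) with ⟨e1, -⟩ | ⟨e1, -⟩ <;> rw [e0, e1] at key
      · refine key m1 m2 ?_
        ext i; fin_cases i <;> simp <;> ring
      · refine key m5 m4 ?_
        ext i; fin_cases i <;> simp <;> ring
      · refine key m1 m8 ?_
        ext i; fin_cases i <;> simp <;> ring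
      · refine key m5 m6 ?_
        ext i; fin_cases i <;> simp <;> ring
    · rw [abs_of_nonpos (by linarith), min_eq_right hle] at key
      rcases abs_cases (v 0) with ⟨e0, -⟩ | ⟨e0, -⟩ <;>
        rcases abs_cases (v 1) with ⟨e1, -⟩ | ⟨e1, -⟩ <;> rw [e0, e1] at key
      · refine key m3 m2 ?_
        ext i; fin_cases i <;> simp <;> ring
      · refine key m3 m4 ?_
        ext i; fin_cases i <;> simp <;> ring
      · refine key m7 m8 ?_
        ext i; fin_cases i <;> simp <;> ring
      · refine key m7 m6 ?_
        ext i; fin_cases i <;> simp <;> ring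

theorem isLimitingShape_square {n h : ℝ} (h0 : 7 / 10 ≤ h) (hh : h < 13 / 18)
    (hn0 : 4 - 4 * h ≤ n) (hn : n ≤ 16 - 20 * h) :
    IsLimitingShape square (splitCluster 2 n h) (fun t : ℕ => 2 / (t : ℝ)) := by
  rw [square_eq]
  rcases hn.lt_or_eq with hlt | heq
  · refine isLimitingShape_octagonal two_pos le_rfl zero_le_one
      (isFirstSplit_square h0 hh hn0 hlt) fun x j => ?_
    have h1 : 2 * (x + j) - j % 2 ≤ 2 * (x + j) := Nat.sub_le _ _
    have h2 : 2 * (x + j) ≤ 2 * (x + j) - j % 2 + 2 := by omega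
    rify at h1 h2
    rw [abs_le]
    push_cast
    constructor <;> linarith
  · refine isLimitingShape_octagonal two_pos le_rfl zero_le_one
      (isFirstSplit_critical h0 hh heq) fun x j => ?_
    have h1 : criticalTime x j ≤ 2 * (x + j) := by
      unfold criticalTime
      split_ifs <;> omega
    have h2 : 2 * (x + j) ≤ criticalTime x j + 2 := by
      unfold criticalTime
      split_ifs <;> omega
    rify at h1 h2
    rw [abs_le]
    push_cast
    constructor <;> linarith

theorem isLimitingShape_octagon {n h : ℝ} (h0 : 5 / 7 ≤ h) (hh : h < 13 / 18) (hn : n = 3) :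
    IsLimitingShape octagon (splitCluster 2 n h) (fun t : ℕ => 5 / (3 * (t : ℝ))) := by
  have e : (fun t : ℕ => 5 / (3 * (t : ℝ))) = fun t : ℕ => (5 / 3 : ℝ) / t :=
    funext fun t => div_mul_eq_div_div _ _ _
  rw [octagon_eq, e]
  refine isLimitingShape_octagonal (by norm_num) (by norm_num) (by norm_num)
    (isFirstSplit_octagon h0 hh hn) fun x j => ?_
  -- Rounding `j` to multiples of three changes `5 / 3 * j` by only `2 / 3 * (j % 3)`.
  have h1 : 3 * (2 * x + 5 * (j / 3) + j % 3) ≤ 6 * x + 5 * j + 6 := by omega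
  have h2 : 6 * x + 5 * j ≤ 3 * (2 * x + 5 * (j / 3) + j % 3) + 6 := by omega
  have h1' : (3 * ((2 * x + 5 * (j / 3) + j % 3 : ℕ) : ℝ)) ≤ 6 * x + 5 * j + 6 := by
    exact_mod_cast h1
  have h2' : (6 * x + 5 * j : ℝ) ≤ 3 * ((2 * x + 5 * (j / 3) + j % 3 : ℕ) : ℝ) + 6 := by
    exact_mod_cast h2
  rw [abs_le]
  rw [Nat.cast_add x j]
  constructor <;> linarith

end SplittingModel

theorem theorem3p1 :
    (∀ (d : ℕ) (n h : ℝ), 1 ≤ d → 1 - 1 / (2 * (d : ℝ)) ≤ h → h < 1 → 1 ≤ n →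
      SplittingModel.IsLimitingShape (SplittingModel.diamond d)
        (SplittingModel.splitCluster d n h) (fun t : ℕ => 1 / (t : ℝ))) ∧
    (∀ n h : ℝ, 7 / 10 ≤ h → h < 40 / 57 → 4 - 4 * h ≤ n → n ≤ 16 - 20 * h →
      SplittingModel.IsLimitingShape SplittingModel.square
        (SplittingModel.splitCluster 2 n h) (fun t : ℕ => 2 / (t : ℝ))) ∧
    (∀ n h : ℝ, 5 / 7 ≤ h → h < 13 / 18 → n = 3 →
      SplittingModel.IsLimitingShape SplittingModel.octagon
        (SplittingModel.splitCluster 2 n h) (fun t : ℕ => 5 / (3 * (t : ℝ)))) :=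
  ⟨fun _ _ _ hd h0 hh hn => SplittingModel.isLimitingShape_diamond hd h0 hh hn,
    -- Since `40 / 57 < 13 / 18`, the range of `h` lies inside the one on which the square
    -- invariants close up.
    fun _ _ h0 hh hn0 hn => SplittingModel.isLimitingShape_square h0 (by linarith) hn0 hn,
    fun _ _ h0 hh hn => SplittingModel.isLimitingShape_octagon h0 hh hn⟩
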